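/- Let $X,Y$ be nonempty compact Hausdorff spaces. Let $S_{X,Y}$ be the set of unitary equivalence classes of pairs $(\rho,\sigma)$, where $\mathcal H$ is a finite dimensional complex Hilbert space (possibly zero dimensional) and $\rho:X\to\mathcal B(\mathcal H)$, $\sigma:Y\to\mathcal B(\mathcal H)$ are continuous with positive definite values. With pointwise direct sum and tensor product, $S_{X,Y}$ is a commutative semiring; it is preordered by relative submajorization: $(\rho,\sigma)\succcurlyeq(\rho',\sigma')$ iff there is a completely positive trace-nonincreasing map $T:\mathcal B(\mathcal H)\to\mathcal B(\mathcal H')$ with $T(\rho(x))\ge\rho'(x)$ for all $x\in X$ and $T(\sigma(y))\le\sigma'(y)$ for all $y\in Y$. Let $S^{\mathrm c}_{X,Y}$ be the subsemiring generated by the one-dimensional pairs (pairs of strictly positive continuous functions). A real spectral point is a monotone semiring homomorphism $S_{X,Y}\to\mathbb R_{\ge0}$. A tropical spectral point is a monotone semiring homomorphism from $S_{X,Y}$ to $\mathbb{TR}=(\mathbb R_{\ge 0},\max,\cdot,\le)$ that takes the value $2$ on the one-dimensional pair $u=(2,1)$ of constant functions. Let $(\rho,\sigma)\in S_{X,Y}$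 satisfy $[\sigma(y),\sigma(y')]=0$ for all $y,y'\in Y$, let $x\in X$, and let $\gamma$ be a Borel probability measure on $Y$. (i) Let $\alpha\ge1$ and let $\tilde f$ be a real spectral point whose restriction to $S^{\mathrm c}_{X,Y}$ is $$f_{\alpha,x,\gamma}\Big(\bigoplus_{i=1}^d p_i,\bigoplus_{i=1}^d q_i\Big)=\sum_{i=1}^d p_i(x)^\alpha\exp\Big[(1-\alpha)\int_Y\ln q_i\,d\gamma\Big].$$ Then $$\tilde f(\rho,\sigma)=\widetilde Q_\alpha\Big(\rho(x)\,\Big\|\,\exp\int_Y\ln\sigma\,d\gamma\Big),\qquad \widetilde Q_\alpha(A\|B)=\operatorname{Tr}\Big(B^{\frac{1-\alpha}{2\alpha}}AB^{\frac{1-\alpha}{2\alpha}}\Big)^{\alpha}.$$ (ii) Let $\tilde g$ be a tropical spectral point whose restriction to $S^{\mathrm c}_{X,Y}$ is $$g_{x,\gamma}\Big(\bigoplus_{i=1}^d p_i,\bigoplus_{i=1}^d q_i\Big)=\max_{1\le i\le d} p_i(x)\exp\Big[-\int_Y\ln q_i\,d\gamma\Big]$$ (with value $0$ for $d=0$). Then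 $$\tilde g(\rho,\sigma)=\Big\|\rho(x)^{1/2}\Big(\exp\int_Y\ln\sigma\,d\gamma\Big)^{-1}\rho(x)^{1/2}\Big\|_\infty,$$ where $\|\cdot\|_\infty$ is the operator norm (equal to $0$ on the zero dimensional space). -/

import Mathlib

open scoped Matrix Kronecker ComplexOrder NNReal
open MeasureTheory

universe u v

noncomputable section

/-! ### Pairs of families of positive definite operators -/

/-- A pair `(ρ, σ)` of continuous families of positive definite operators, indexed by `X` and by
`Y`, on one finite dimensional Hilbert space `ℂ^ι` (operators are written as matrices). The index
type `ι` may be empty; this is the zero dimensional Hilbert space. -/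
structure FamilyPair (X : Type u) (Y : Type v) [TopologicalSpace X] [TopologicalSpace Y] :
    Type (max u v 1) where
  ι : Type
  [fintype : Fintype ι]
  [decEq : DecidableEq ι]
  rho : X → Matrix ι ι ℂ
  sigma : Y → Matrix ι ι ℂ
  rho_cont : Continuous rho
  sigma_cont : Continuous sigma
  rho_posDef : ∀ x, (rho x).PosDef
  sigma_posDef : ∀ y, (sigma y).PosDef

attribute [instance] FamilyPair.fintype FamilyPair.decEq

/-- Strictly positive continuous functions. -/
abbrev PosFun (X : Type u) [TopologicalSpace X] : Type u := {p : C(X, ℝ) // ∀ x, 0 < p x}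

/-- The ampliation `T ⊗ id` of `T : B(ℂ^ι) → B(ℂ^κ)` to `n × n` block matrices. -/
def ampliation {ι κ : Type} (T : Matrix ι ι ℂ →ₗ[ℂ] Matrix κ κ ℂ) (n : ℕ)
    (M : Matrix (ι × Fin n) (ι × Fin n) ℂ) : Matrix (κ × Fin n) (κ × Fin n) ℂ :=
  Matrix.of fun k l => T (Matrix.of fun i j => M (i, k.2) (j, l.2)) k.1 l.1

/-- `T` is completely positive: every ampliation `T ⊗ id_n` maps positive semidefinite matrices to
positive semidefinite matrices. -/
def IsCompletelyPositive {ι κ : Type} (T : Matrix ι ι ℂ →ₗ[ℂ] Matrix κ κ ℂ) : Prop :=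
  ∀ (n : ℕ) (M : Matrix (ι × Fin n) (ι × Fin n) ℂ), M.PosSemidef → (ampliation T n M).PosSemidef

/-- `T` does not increase the trace of positive semidefinite operators. -/
def IsTraceNonincreasing {ι κ : Type} [Fintype ι] [Fintype κ]
    (T : Matrix ι ι ℂ →ₗ[ℂ] Matrix κ κ ℂ) : Prop :=
  ∀ A : Matrix ι ι ℂ, A.PosSemidef → (T A).trace.re ≤ A.trace.re

/-- Conjugation `A ↦ U A U*`. -/
def conjMap {ι κ : Type} [Fintype ι] [Fintype κ] (U : Matrix κ ι ℂ) :
    Matrix ι ι ℂ →ₗ[ℂ] Matrix κ κ ℂ where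
  toFun A := U * A * Uᴴ
  map_add' A B := by rw [Matrix.mul_add, Matrix.add_mul]
  map_smul' c A := by simp

theorem conjMap_completelyPositive {ι κ : Type} [Fintype ι] [Fintype κ] (U : Matrix κ ι ℂ) :
    IsCompletelyPositive (conjMap U) := by
  intro n M hM
  have h := hM.mul_mul_conjTranspose_same (U ⊗ₖ (1 : Matrix (Fin n) (Fin n) ℂ))
  convert h using 1
  ext ⟨k, a⟩ ⟨l, b⟩
  simp [ampliation, conjMap, Matrix.mul_apply, Fintype.sum_prod_type, Matrix.one_apply,
    apply_ite (starRingEnd ℂ)]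

theorem posDef_fromBlocks {ι κ : Type} [Fintype ι] [Fintype κ] [DecidableEq ι]
    [DecidableEq κ] {A : Matrix ι ι ℂ} {D : Matrix κ κ ℂ} (hA : A.PosDef) (hD : D.PosDef) :
    (Matrix.fromBlocks A 0 0 D).PosDef := by
  refine Matrix.PosDef.of_dotProduct_mulVec_pos ?_ fun {x} hx => ?_
  · exact Matrix.IsHermitian.fromBlocks hA.1 (by simp) hD.1
  · have hsplit : star x ⬝ᵥ (Matrix.fromBlocks A 0 0 D *ᵥ x)
        = star (x ∘ Sum.inl) ⬝ᵥ (A *ᵥ (x ∘ Sum.inl))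
          + star (x ∘ Sum.inr) ⬝ᵥ (D *ᵥ (x ∘ Sum.inr)) := by
      rw [Matrix.fromBlocks_mulVec]
      simp [dotProduct, Fintype.sum_sum_type]
    rw [hsplit]
    by_cases h1 : x ∘ Sum.inl = 0
    · have h2 : x ∘ Sum.inr ≠ 0 := by
        intro h2
        apply hx
        funext i
        rcases i with i | i
        · exact congrFun h1 i
        · exact congrFun h2 i
      exact add_pos_of_nonneg_of_pos (hA.posSemidef.dotProduct_mulVec_nonneg _)
        (hD.dotProduct_mulVec_pos h2)
    · exact add_pos_of_pos_of_nonneg (hA.dotProduct_mulVec_pos h1)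
        (hD.posSemidef.dotProduct_mulVec_nonneg _)

/-- The matrix of the unitary `ℂ^ι → ℂ^κ` that a bijection `ι ≃ κ` induces. -/
def equivMatrix {ι κ : Type} [DecidableEq κ] (e : ι ≃ κ) : Matrix κ ι ℂ :=
  (1 : Matrix κ κ ℂ).submatrix id e

theorem equivMatrix_conj {ι κ : Type} [Fintype ι] [Fintype κ] [DecidableEq κ]
    (e : ι ≃ κ) (A : Matrix ι ι ℂ) :
    equivMatrix e * A * (equivMatrix e)ᴴ = A.submatrix e.symm e.symm := by
  classical
  ext k l
  obtain ⟨k, rfl⟩ := e.surjective k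
  obtain ⟨l, rfl⟩ := e.surjective l
  simp [equivMatrix, Matrix.mul_apply, Matrix.one_apply, e.injective.eq_iff]

theorem equivMatrix_mul_star {ι κ : Type} [Fintype ι] [DecidableEq κ]
    (e : ι ≃ κ) : equivMatrix e * (equivMatrix e)ᴴ = 1 := by
  classical
  ext k l
  obtain ⟨k, rfl⟩ := e.surjective k
  obtain ⟨l, rfl⟩ := e.surjective l
  simp [equivMatrix, Matrix.mul_apply, Matrix.one_apply, e.injective.eq_iff, eq_comm]

theorem star_mul_equivMatrix {ι κ : Type} [Fintype κ] [DecidableEq ι] [DecidableEq κ]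
    (e : ι ≃ κ) : (equivMatrix e)ᴴ * equivMatrix e = 1 := by
  ext k l
  simp [equivMatrix, Matrix.mul_apply, Matrix.one_apply]

theorem blocks_star_mul {ι κ ι' κ' : Type} [Fintype ι] [Fintype κ] [Fintype ι'] [Fintype κ']
    (U : Matrix κ ι ℂ) (V : Matrix κ' ι' ℂ) :
    (Matrix.fromBlocks U 0 0 V)ᴴ * Matrix.fromBlocks U 0 0 V
      = Matrix.fromBlocks (Uᴴ * U) 0 0 (Vᴴ * V) := by
  rw [Matrix.fromBlocks_conjTranspose, Matrix.fromBlocks_multiply]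
  simp

theorem blocks_mul_star {ι κ ι' κ' : Type} [Fintype ι] [Fintype κ] [Fintype ι'] [Fintype κ']
    (U : Matrix κ ι ℂ) (V : Matrix κ' ι' ℂ) :
    Matrix.fromBlocks U 0 0 V * (Matrix.fromBlocks U 0 0 V)ᴴ
      = Matrix.fromBlocks (U * Uᴴ) 0 0 (V * Vᴴ) := by
  rw [Matrix.fromBlocks_conjTranspose, Matrix.fromBlocks_multiply]
  simp

theorem blocks_conj {ι κ ι' κ' : Type} [Fintype ι] [Fintype κ] [Fintype ι'] [Fintype κ']
    (U : Matrix κ ι ℂ) (V : Matrix κ' ι' ℂ)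
    (A : Matrix ι ι ℂ) (D : Matrix ι' ι' ℂ) :
    Matrix.fromBlocks U 0 0 V * Matrix.fromBlocks A 0 0 D * (Matrix.fromBlocks U 0 0 V)ᴴ
      = Matrix.fromBlocks (U * A * Uᴴ) 0 0 (V * D * Vᴴ) := by
  rw [Matrix.fromBlocks_conjTranspose, Matrix.fromBlocks_multiply, Matrix.fromBlocks_multiply]
  simp

theorem kronecker_star_mul {ι κ ι' κ' : Type} [Fintype ι] [Fintype κ] [Fintype ι'] [Fintype κ']
    (U : Matrix κ ι ℂ) (V : Matrix κ' ι' ℂ) :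
    (U ⊗ₖ V)ᴴ * (U ⊗ₖ V) = (Uᴴ * U) ⊗ₖ (Vᴴ * V) := by
  rw [Matrix.conjTranspose_kronecker, Matrix.mul_kronecker_mul]

theorem kronecker_mul_star {ι κ ι' κ' : Type} [Fintype ι] [Fintype κ] [Fintype ι'] [Fintype κ']
    (U : Matrix κ ι ℂ) (V : Matrix κ' ι' ℂ) :
    (U ⊗ₖ V) * (U ⊗ₖ V)ᴴ = (U * Uᴴ) ⊗ₖ (V * Vᴴ) := by
  rw [Matrix.conjTranspose_kronecker, Matrix.mul_kronecker_mul]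

theorem kronecker_conj {ι κ ι' κ' : Type} [Fintype ι] [Fintype κ] [Fintype ι'] [Fintype κ']
    (U : Matrix κ ι ℂ) (V : Matrix κ' ι' ℂ)
    (A : Matrix ι ι ℂ) (D : Matrix ι' ι' ℂ) :
    (U ⊗ₖ V) * (A ⊗ₖ D) * (U ⊗ₖ V)ᴴ = (U * A * Uᴴ) ⊗ₖ (V * D * Vᴴ) := by
  rw [Matrix.conjTranspose_kronecker, Matrix.mul_kronecker_mul, Matrix.mul_kronecker_mul]

namespace FamilyPair

variable {X : Type u} {Y : Type v} [TopologicalSpace X] [TopologicalSpace Y]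

/-- Unitary equivalence of pairs of families. -/
def Equivalent (P Q : FamilyPair X Y) : Prop :=
  ∃ U : Matrix Q.ι P.ι ℂ, Uᴴ * U = 1 ∧ U * Uᴴ = 1 ∧
    (∀ x, U * P.rho x * Uᴴ = Q.rho x) ∧ ∀ y, U * P.sigma y * Uᴴ = Q.sigma y

theorem Equivalent.symm {P Q : FamilyPair X Y} (h : Equivalent P Q) : Equivalent Q P := by
  obtain ⟨U, h1, h2, h3, h4⟩ := h
  refine ⟨Uᴴ, by simpa using h2, by simpa using h1, fun x => ?_, fun y => ?_⟩
  · rw [← h3 x, Matrix.conjTranspose_conjTranspose]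
    calc Uᴴ * (U * P.rho x * Uᴴ) * U = (Uᴴ * U) * P.rho x * (Uᴴ * U) := by
          simp only [Matrix.mul_assoc]
      _ = _ := by rw [h1, Matrix.one_mul, Matrix.mul_one]
  · rw [← h4 y, Matrix.conjTranspose_conjTranspose]
    calc Uᴴ * (U * P.sigma y * Uᴴ) * U = (Uᴴ * U) * P.sigma y * (Uᴴ * U) := by
          simp only [Matrix.mul_assoc]
      _ = _ := by rw [h1, Matrix.one_mul, Matrix.mul_one]

theorem Equivalent.trans {P Q R : FamilyPair X Y} (h : Equivalent P Q) (h' : Equivalent Q R) :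
    Equivalent P R := by
  obtain ⟨U, h1, h2, h3, h4⟩ := h
  obtain ⟨V, k1, k2, k3, k4⟩ := h'
  refine ⟨V * U, ?_, ?_, fun x => ?_, fun y => ?_⟩
  · rw [Matrix.conjTranspose_mul]
    calc Uᴴ * Vᴴ * (V * U) = Uᴴ * (Vᴴ * V) * U := by simp only [Matrix.mul_assoc]
      _ = 1 := by rw [k1, Matrix.mul_one, h1]
  · rw [Matrix.conjTranspose_mul]
    calc V * U * (Uᴴ * Vᴴ) = V * (U * Uᴴ) * Vᴴ := by simp only [Matrix.mul_assoc]
      _ = 1 := by rw [h2, Matrix.mul_one, k2]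
  · rw [← k3 x, ← h3 x, Matrix.conjTranspose_mul]
    simp only [Matrix.mul_assoc]
  · rw [← k4 y, ← h4 y, Matrix.conjTranspose_mul]
    simp only [Matrix.mul_assoc]

/-- Pairs that differ by a relabelling of the basis are equivalent. -/
theorem Equivalent.of_equiv {P Q : FamilyPair X Y} (e : P.ι ≃ Q.ι)
    (h1 : ∀ x i j, P.rho x i j = Q.rho x (e i) (e j))
    (h2 : ∀ y i j, P.sigma y i j = Q.sigma y (e i) (e j)) : Equivalent P Q := by
  refine ⟨equivMatrix e, star_mul_equivMatrix e, equivMatrix_mul_star e, fun x => ?_, fun y => ?_⟩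
  · rw [equivMatrix_conj]
    ext k l
    simp [h1]
  · rw [equivMatrix_conj]
    ext k l
    simp [h2]

theorem Equivalent.refl (P : FamilyPair X Y) : Equivalent P P :=
  Equivalent.of_equiv (Equiv.refl _) (fun _ _ _ => rfl) (fun _ _ _ => rfl)

instance instSetoid (X : Type u) (Y : Type v) [TopologicalSpace X] [TopologicalSpace Y] :
    Setoid (FamilyPair X Y) :=
  ⟨Equivalent, Equivalent.refl, Equivalent.symm, Equivalent.trans⟩

/-- Pointwise direct sum. -/
def dsum (P Q : FamilyPair X Y) : FamilyPair X Y where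
  ι := P.ι ⊕ Q.ι
  rho x := Matrix.fromBlocks (P.rho x) 0 0 (Q.rho x)
  sigma y := Matrix.fromBlocks (P.sigma y) 0 0 (Q.sigma y)
  rho_cont := P.rho_cont.matrix_fromBlocks continuous_const continuous_const Q.rho_cont
  sigma_cont := P.sigma_cont.matrix_fromBlocks continuous_const continuous_const Q.sigma_cont
  rho_posDef x := posDef_fromBlocks (P.rho_posDef x) (Q.rho_posDef x)
  sigma_posDef y := posDef_fromBlocks (P.sigma_posDef y) (Q.sigma_posDef y)

/-- Pointwise tensor product. -/
def tensor (P Q : FamilyPair X Y) : FamilyPair X Y where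
  ι := P.ι × Q.ι
  rho x := P.rho x ⊗ₖ Q.rho x
  sigma y := P.sigma y ⊗ₖ Q.sigma y
  rho_cont := continuous_matrix fun i j =>
    (P.rho_cont.matrix_elem i.1 j.1).mul (Q.rho_cont.matrix_elem i.2 j.2)
  sigma_cont := continuous_matrix fun i j =>
    (P.sigma_cont.matrix_elem i.1 j.1).mul (Q.sigma_cont.matrix_elem i.2 j.2)
  rho_posDef x := (P.rho_posDef x).kronecker (Q.rho_posDef x)
  sigma_posDef y := (P.sigma_posDef y).kronecker (Q.sigma_posDef y)

/-- The pair on the zero dimensional Hilbert space. -/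
def zeroPair (X : Type u) (Y : Type v) [TopologicalSpace X] [TopologicalSpace Y] :
    FamilyPair X Y where
  ι := Empty
  rho _ := 1
  sigma _ := 1
  rho_cont := continuous_const
  sigma_cont := continuous_const
  rho_posDef _ := Matrix.PosDef.one
  sigma_posDef _ := Matrix.PosDef.one

/-- The pair of constant families with value `I` over `ℂ`. -/
def onePair (X : Type u) (Y : Type v) [TopologicalSpace X] [TopologicalSpace Y] :
    FamilyPair X Y where
  ι := Unit
  rho _ := 1
  sigma _ := 1
  rho_cont := continuous_const
  sigma_cont := continuous_const
  rho_posDef _ := Matrix.PosDef.one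
  sigma_posDef _ := Matrix.PosDef.one

/-- The pair of families over `ℂ` given by two strictly positive continuous functions. -/
def ofPosFun (p : PosFun X) (q : PosFun Y) : FamilyPair X Y where
  ι := Unit
  rho x := Matrix.diagonal fun _ => ((p.1 x : ℝ) : ℂ)
  sigma y := Matrix.diagonal fun _ => ((q.1 y : ℝ) : ℂ)
  rho_cont := Continuous.matrix_diagonal
    (continuous_pi fun _ => Complex.continuous_ofReal.comp p.1.continuous)
  sigma_cont := Continuous.matrix_diagonal
    (continuous_pi fun _ => Complex.continuous_ofReal.comp q.1.continuous)
  rho_posDef x := Matrix.PosDef.diagonal fun _ => by exact_mod_cast p.2 x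
  sigma_posDef y := Matrix.PosDef.diagonal fun _ => by exact_mod_cast q.2 y

theorem dsum_congr {P P' Q Q' : FamilyPair X Y} (h : Equivalent P P') (k : Equivalent Q Q') :
    Equivalent (dsum P Q) (dsum P' Q') := by
  obtain ⟨U, h1, h2, h3, h4⟩ := h
  obtain ⟨V, k1, k2, k3, k4⟩ := k
  refine ⟨Matrix.fromBlocks U 0 0 V, ?_, ?_, fun x => ?_, fun y => ?_⟩
  · exact (blocks_star_mul U V).trans (by rw [h1, k1, Matrix.fromBlocks_one]; rfl)
  · exact (blocks_mul_star U V).trans (by rw [h2, k2, Matrix.fromBlocks_one]; rfl)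
  · exact (blocks_conj U V _ _).trans (by rw [h3, k3]; rfl)
  · exact (blocks_conj U V _ _).trans (by rw [h4, k4]; rfl)

theorem tensor_congr {P P' Q Q' : FamilyPair X Y} (h : Equivalent P P') (k : Equivalent Q Q') :
    Equivalent (tensor P Q) (tensor P' Q') := by
  obtain ⟨U, h1, h2, h3, h4⟩ := h
  obtain ⟨V, k1, k2, k3, k4⟩ := k
  refine ⟨U ⊗ₖ V, ?_, ?_, fun x => ?_, fun y => ?_⟩
  · exact (kronecker_star_mul U V).trans (by rw [h1, k1, Matrix.one_kronecker_one]; rfl)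
  · exact (kronecker_mul_star U V).trans (by rw [h2, k2, Matrix.one_kronecker_one]; rfl)
  · exact (kronecker_conj U V _ _).trans (by rw [h3, k3]; rfl)
  · exact (kronecker_conj U V _ _).trans (by rw [h4, k4]; rfl)

/-- `(ρ, σ)` relatively submajorizes `(ρ', σ')`: some completely positive trace-nonincreasing map
`T` satisfies `T(ρ(x)) ≥ ρ'(x)` for all `x` and `T(σ(y)) ≤ σ'(y)` for all `y`. -/
def RelSubmaj (P Q : FamilyPair X Y) : Prop :=
  ∃ T : Matrix P.ι P.ι ℂ →ₗ[ℂ] Matrix Q.ι Q.ι ℂ,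
    IsCompletelyPositive T ∧ IsTraceNonincreasing T ∧
      (∀ x, (T (P.rho x) - Q.rho x).PosSemidef) ∧ ∀ y, (Q.sigma y - T (P.sigma y)).PosSemidef

theorem RelSubmaj.of_equivalent {P Q : FamilyPair X Y} (h : Equivalent P Q) : RelSubmaj P Q := by
  obtain ⟨U, h1, h2, h3, h4⟩ := h
  refine ⟨conjMap U, conjMap_completelyPositive U, fun A _ => ?_, fun x => ?_, fun y => ?_⟩
  · have : (conjMap U A).trace = A.trace := by
      change (U * A * Uᴴ).trace = _
      rw [Matrix.trace_mul_comm, ← Matrix.mul_assoc, h1, Matrix.one_mul]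
    rw [this]
  · change (U * P.rho x * Uᴴ - Q.rho x).PosSemidef
    rw [h3, sub_self]
    exact Matrix.PosSemidef.zero
  · change (Q.sigma y - U * P.sigma y * Uᴴ).PosSemidef
    rw [h4, sub_self]
    exact Matrix.PosSemidef.zero

end FamilyPair

theorem IsCompletelyPositive.posSemidef {ι κ : Type}
    {T : Matrix ι ι ℂ →ₗ[ℂ] Matrix κ κ ℂ} (hT : IsCompletelyPositive T) {A : Matrix ι ι ℂ}
    (hA : A.PosSemidef) : (T A).PosSemidef := by
  have h := hT 1 (A.submatrix Prod.fst Prod.fst) (hA.submatrix _)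
  exact h.submatrix fun k => (k, 0)

namespace FamilyPair

variable {X : Type u} {Y : Type v} [TopologicalSpace X] [TopologicalSpace Y]

theorem RelSubmaj.trans {P Q R : FamilyPair X Y} (h : RelSubmaj P Q) (k : RelSubmaj Q R) :
    RelSubmaj P R := by
  obtain ⟨T, h1, h2, h3, h4⟩ := h
  obtain ⟨S, k1, k2, k3, k4⟩ := k
  refine ⟨S ∘ₗ T, fun n M hM => k1 n _ (h1 n M hM), fun A hA => ?_, fun x => ?_, fun y => ?_⟩
  · exact (k2 _ (h1.posSemidef hA)).trans (h2 A hA)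
  · have := (k1.posSemidef (h3 x)).add (k3 x)
    simpa using this
  · have := (k1.posSemidef (h4 y)).add (k4 y)
    simpa using this

end FamilyPair

/-! ### The preordered semiring of pairs of families -/

/-- Unitary equivalence classes of pairs of families. -/
def FamilySemiring (X : Type u) (Y : Type v) [TopologicalSpace X] [TopologicalSpace Y] :
    Type (max u v 1) :=
  Quotient (FamilyPair.instSetoid X Y)

namespace FamilySemiring

variable {X : Type u} {Y : Type v} [TopologicalSpace X] [TopologicalSpace Y]

/-- The class of a pair. -/
def mk (P : FamilyPair X Y) : FamilySemiring X Y := Quotient.mk _ P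

theorem mk_eq_mk {P Q : FamilyPair X Y} : mk P = mk Q ↔ FamilyPair.Equivalent P Q :=
  Quotient.eq

instance : Zero (FamilySemiring X Y) := ⟨mk (FamilyPair.zeroPair X Y)⟩

instance : One (FamilySemiring X Y) := ⟨mk (FamilyPair.onePair X Y)⟩

instance : Add (FamilySemiring X Y) :=
  ⟨Quotient.map₂ FamilyPair.dsum fun _ _ h _ _ k => FamilyPair.dsum_congr h k⟩

instance : Mul (FamilySemiring X Y) :=
  ⟨Quotient.map₂ FamilyPair.tensor fun _ _ h _ _ k => FamilyPair.tensor_congr h k⟩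

theorem mk_add_mk (P Q : FamilyPair X Y) : mk P + mk Q = mk (P.dsum Q) := rfl

theorem mk_mul_mk (P Q : FamilyPair X Y) : mk P * mk Q = mk (P.tensor Q) := rfl

theorem add_comm_aux (a b : FamilySemiring X Y) : a + b = b + a := by
  obtain ⟨P⟩ := a
  obtain ⟨Q⟩ := b
  refine mk_eq_mk.2 (.of_equiv (Equiv.sumComm _ _) ?_ ?_) <;>
  · rintro x (i | i) (j | j) <;> rfl

theorem mul_comm_aux (a b : FamilySemiring X Y) : a * b = b * a := by
  obtain ⟨P⟩ := a
  obtain ⟨Q⟩ := b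
  refine mk_eq_mk.2 (.of_equiv (Equiv.prodComm _ _) ?_ ?_) <;>
  · rintro x ⟨i, i'⟩ ⟨j, j'⟩
    exact mul_comm _ _

theorem add_assoc_aux (a b c : FamilySemiring X Y) : a + b + c = a + (b + c) := by
  obtain ⟨P⟩ := a
  obtain ⟨Q⟩ := b
  obtain ⟨R⟩ := c
  refine mk_eq_mk.2 (.of_equiv (Equiv.sumAssoc _ _ _) ?_ ?_) <;>
  · rintro x ((i | i) | i) ((j | j) | j) <;> rfl

theorem mul_assoc_aux (a b c : FamilySemiring X Y) : a * b * c = a * (b * c) := by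
  obtain ⟨P⟩ := a
  obtain ⟨Q⟩ := b
  obtain ⟨R⟩ := c
  refine mk_eq_mk.2 (.of_equiv (Equiv.prodAssoc _ _ _) ?_ ?_) <;>
  · rintro x ⟨⟨i, i'⟩, i''⟩ ⟨⟨j, j'⟩, j''⟩
    exact mul_assoc _ _ _

theorem zero_add_aux (a : FamilySemiring X Y) : 0 + a = a := by
  obtain ⟨P⟩ := a
  refine mk_eq_mk.2 (.of_equiv (Equiv.emptySum Empty _) ?_ ?_) <;>
  · rintro x (i | i) (j | j) <;> first | exact i.elim | exact j.elim | rfl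

theorem one_mul_aux (a : FamilySemiring X Y) : 1 * a = a := by
  obtain ⟨P⟩ := a
  refine mk_eq_mk.2 (.of_equiv (Equiv.punitProd _) ?_ ?_) <;>
  · rintro x ⟨i, i'⟩ ⟨j, j'⟩
    exact one_mul _

theorem zero_mul_aux (a : FamilySemiring X Y) : 0 * a = 0 := by
  obtain ⟨P⟩ := a
  refine mk_eq_mk.2 (.of_equiv (Equiv.equivOfIsEmpty (Empty × P.ι) Empty) ?_ ?_) <;>
  · rintro x ⟨i, i'⟩
    exact i.elim

theorem right_distrib_aux (a b c : FamilySemiring X Y) : (a + b) * c = a * c + b * c := by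
  obtain ⟨P⟩ := a
  obtain ⟨Q⟩ := b
  obtain ⟨R⟩ := c
  refine mk_eq_mk.2 (.of_equiv (Equiv.sumProdDistrib _ _ _) ?_ ?_) <;>
  · rintro x ⟨i | i, i'⟩ ⟨j | j, j'⟩ <;>
      first | rfl | exact zero_mul _

instance : CommSemiring (FamilySemiring X Y) where
  add_assoc := add_assoc_aux
  zero_add := zero_add_aux
  add_zero a := (add_comm_aux a 0).trans (zero_add_aux a)
  add_comm := add_comm_aux
  left_distrib a b c := by
    rw [mul_comm_aux, right_distrib_aux, mul_comm_aux b, mul_comm_aux c]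
  right_distrib := right_distrib_aux
  zero_mul := zero_mul_aux
  mul_zero a := (mul_comm_aux a 0).trans (zero_mul_aux a)
  mul_assoc := mul_assoc_aux
  one_mul := one_mul_aux
  mul_one a := (mul_comm_aux a 1).trans (one_mul_aux a)
  mul_comm := mul_comm_aux
  nsmul := nsmulRec
  npow := npowRec

/-- The preorder: `a ≤ b` means that `b` relatively submajorizes `a`. -/
instance : Preorder (FamilySemiring X Y) where
  le := Quotient.lift₂ (fun P Q => FamilyPair.RelSubmaj Q P) fun _ _ _ _ h k => propext
    ⟨fun H => ((FamilyPair.RelSubmaj.of_equivalent k.symm).trans H).trans (.of_equivalent h),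
      fun H => ((FamilyPair.RelSubmaj.of_equivalent k).trans H).trans (.of_equivalent h.symm)⟩
  le_refl := by
    rintro ⟨P⟩
    exact FamilyPair.RelSubmaj.of_equivalent (.refl P)
  le_trans := by
    rintro ⟨P⟩ ⟨Q⟩ ⟨R⟩ h k
    exact FamilyPair.RelSubmaj.trans k h

theorem mk_le_mk {P Q : FamilyPair X Y} : mk P ≤ mk Q ↔ FamilyPair.RelSubmaj Q P := Iff.rfl

/-- The one-dimensional element given by a pair of strictly positive continuous functions. -/
def oneDim (p : PosFun X) (q : PosFun Y) : FamilySemiring X Y := mk (FamilyPair.ofPosFun p q)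

/-- The power universal element `u = (2, 1)`. -/
def powerUniversal (X : Type u) (Y : Type v) [TopologicalSpace X] [TopologicalSpace Y] :
    FamilySemiring X Y :=
  oneDim ⟨ContinuousMap.const X 2, fun _ => two_pos⟩ ⟨ContinuousMap.const Y 1, fun _ => one_pos⟩

/-- The subsemiring of classical families, generated by the one-dimensional elements. -/
def classical (X : Type u) (Y : Type v) [TopologicalSpace X] [TopologicalSpace Y] :
    Subsemiring (FamilySemiring X Y) :=
  Subsemiring.closure (Set.range fun pq : PosFun X × PosFun Y => oneDim pq.1 pq.2)

/-- The direct sum `(⨁ pᵢ, ⨁ qᵢ)` of one-dimensional elements, as a classical element. -/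
def classicalSum {d : ℕ} (p : Fin d → PosFun X) (q : Fin d → PosFun Y) : classical X Y :=
  ⟨∑ i, oneDim (p i) (q i), sum_mem fun i _ => Subsemiring.subset_closure ⟨(p i, q i), rfl⟩⟩

end FamilySemiring

/-! ### Real and tropical spectral points -/

/-- The tropical semiring in the multiplicative picture: nonnegative reals with `max` as addition
and the usual multiplication and order. -/
def TropicalReal : Type := ℝ≥0

namespace TropicalReal

instance : LinearOrder TropicalReal := inferInstanceAs (LinearOrder ℝ≥0)

/-- The underlying nonnegative real number. -/
def toNNReal (a : TropicalReal) : ℝ≥0 := a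

/-- A nonnegative real number as an element of the tropical semiring. -/
def ofNNReal (a : ℝ≥0) : TropicalReal := a

instance : Zero TropicalReal := ⟨ofNNReal 0⟩

instance : One TropicalReal := ⟨ofNNReal 1⟩

instance : Add TropicalReal := ⟨fun a b => ofNNReal (max a.toNNReal b.toNNReal)⟩

instance : Mul TropicalReal := ⟨fun a b => ofNNReal (a.toNNReal * b.toNNReal)⟩

instance : CommSemiring TropicalReal where
  add_assoc := max_assoc (α := ℝ≥0)
  zero_add := fun a => max_eq_right (zero_le (a := a.toNNReal))
  add_zero := fun a => max_eq_left (zero_le (a := a.toNNReal))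
  add_comm := max_comm (α := ℝ≥0)
  left_distrib := fun a b c => mul_max (α := ℝ≥0) a b c
  right_distrib := fun a b c => max_mul (α := ℝ≥0) a b c
  zero_mul := zero_mul (M₀ := ℝ≥0)
  mul_zero := mul_zero (M₀ := ℝ≥0)
  mul_assoc := mul_assoc (G := ℝ≥0)
  one_mul := one_mul (M := ℝ≥0)
  mul_one := mul_one (M := ℝ≥0)
  mul_comm := mul_comm (G := ℝ≥0)
  nsmul := nsmulRec
  npow := npowRec

end TropicalReal

/-- The real part of the 1-test spectrum: monotone semiring homomorphisms to `ℝ≥0`. -/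
def realSpectrum (S : Type u) [CommSemiring S] [Preorder S] : Set (S →+* ℝ≥0) :=
  {f | Monotone f}

/-- The tropical part of the 1-test spectrum: monotone semiring homomorphisms to the tropical
semiring, normalized to take the value `2` at the power universal element `w`. -/
def tropicalSpectrum (S : Type u) [CommSemiring S] [Preorder S] (w : S) :
    Set (S →+* TropicalReal) :=
  {g | Monotone g ∧ g w = TropicalReal.ofNNReal 2}

section Classical

variable {X : Type u} {Y : Type v} [TopologicalSpace X] [TopologicalSpace Y] [MeasurableSpace Y]

/-- `f` is the functional `f_{α,x,γ}` on the classical subsemiring: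
`f (⨁ pᵢ, ⨁ qᵢ) = ∑ pᵢ(x)^α exp((1 - α) ∫ ln qᵢ dγ)`. -/
def IsClassicalReal (f : FamilySemiring.classical X Y →+* ℝ≥0) (α : ℝ) (x : X)
    (γ : Measure Y) : Prop :=
  ∀ (d : ℕ) (p : Fin d → PosFun X) (q : Fin d → PosFun Y),
    f (FamilySemiring.classicalSum p q) =
      ∑ i, Real.toNNReal
        ((p i).1 x ^ α * Real.exp ((1 - α) * ∫ y, Real.log ((q i).1 y) ∂γ))

/-- `g` is the functional `g_{x,γ}` on the classical subsemiring:
`g (⨁ pᵢ, ⨁ qᵢ) = max pᵢ(x) exp(-∫ ln qᵢ dγ)` (with value `0` at the zero element). -/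
def IsClassicalTropical (g : FamilySemiring.classical X Y →+* TropicalReal) (x : X)
    (γ : Measure Y) : Prop :=
  ∀ (d : ℕ) (p : Fin d → PosFun X) (q : Fin d → PosFun Y),
    (g (FamilySemiring.classicalSum p q)).toNNReal =
      Finset.univ.sup fun i => Real.toNNReal
        ((p i).1 x * Real.exp (-∫ y, Real.log ((q i).1 y) ∂γ))

end Classical

/-! ### The quantum functionals -/

section Quantum

variable {ι : Type} [Fintype ι] [DecidableEq ι]

/-- Real power of a positive definite matrix, by functional calculus. -/
def matrixPow (A : Matrix ι ι ℂ) (s : ℝ) : Matrix ι ι ℂ := cfc (fun t : ℝ => t ^ s) A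

/-- The sandwiched Rényi quasi-entropy
`Q̃_α(ρ ‖ σ) = Tr (σ^((1-α)/(2α)) ρ σ^((1-α)/(2α)))^α`. -/
def sandwichedQuasiEntropy (α : ℝ) (ρ σ : Matrix ι ι ℂ) : ℝ :=
  (matrixPow (matrixPow σ ((1 - α) / (2 * α)) * ρ * matrixPow σ ((1 - α) / (2 * α))) α).trace.re

/-- `exp ∫ ln σ dγ`, where `ln` is the matrix logarithm and the integral is taken entrywise. -/
def expIntLog {Y : Type v} [MeasurableSpace Y] (γ : Measure Y) (σ : Y → Matrix ι ι ℂ) :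
    Matrix ι ι ℂ :=
  NormedSpace.exp (Matrix.of fun i j => ∫ y, (cfc Real.log (σ y)) i j ∂γ)

/-- The operator norm of a matrix acting on the Hilbert space `ℂ^ι`. -/
def operatorNorm (A : Matrix ι ι ℂ) : ℝ := ‖Matrix.toEuclideanCLM (n := ι) (𝕜 := ℂ) A‖

end Quantum

end

/-! Both spectral points are treated at once. On a direct sum of one-dimensional pairs each takes
the value `N v` with `v i = p i (x) * exp (s * ∫ ln q i dγ)`. In the real case `N v = ∑ i, v i ^ α`
and `s = (1 - α) / α`; in the tropical case `N` is the maximum and `s = -1`. The only properties of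
`N` used are those in `IsAggregate`. The target value is `N` of the eigenvalues of `D ρ(x) D` with
`D = (exp ∫ ln σ dγ) ^ (s / 2)`.

Commuting `σ(y)` have a joint eigenbasis, so after a unitary change of basis `σ` is diagonal.
Suppose its diagonal entries depend only on one of `m` colors of the index. Pinching `ρ(x)` to the
color blocks leaves a matrix that is diagonal in a basis `V` in which `σ` is still diagonal. Let `S`
be the classical value of that pair. Measuring in `V` gives `S ≤ F(ρ, σ)` by monotonicity. The
pinching inequality `ρ(x) ≤ m • pinching` gives `F(ρ, σ) ≤ m ^ K * S`; points other than `x` cost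
nothing, because `ρ(x')` is dominated by `h(x') ρ(x)` with `h(x) = 1` and classical values see only
`x`. Schur majorization and the same pinching inequality place `N` of the eigenvalues of `D ρ(x) D`
between `S` and `m ^ K * S` as well. Hence the two quantities agree up to a factor `m ^ K`
(`IsAggregateFunctional.bounds_of_coloring`).

For the `n`-th tensor power, coloring a multi-index by its letter counts needs at most `(n + 1) ^ d`
colors, where `d` is the dimension. Both quantities are multiplicative on tensor powers, so the
polynomial factor disappears after taking `n`-th roots (`IsAggregateFunctional.eq_of_diagonal`). -/

noncomputable section

/-! ### Unitary diagonalization of matrices -/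

section Diagonalization

variable {ι : Type} [Fintype ι] [DecidableEq ι]

/-- A commuting family of Hermitian matrices is diagonalized by a single unitary. -/
theorem exists_unitary_diagonalizing {κ : Type*} (M : κ → Matrix ι ι ℂ)
    (hM : ∀ k, (M k).IsHermitian) (hc : ∀ k l, Commute (M k) (M l)) :
    ∃ U : Matrix ι ι ℂ, Uᴴ * U = 1 ∧ U * Uᴴ = 1 ∧ ∃ m : κ → ι → ℝ,
      ∀ k, M k = U * Matrix.diagonal (fun i => ((m k i : ℝ) : ℂ)) * Uᴴ := by
  classical
  let T : κ → Module.End ℂ (EuclideanSpace ℂ ι) := fun k => Matrix.toEuclideanLin (M k)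
  have hT : ∀ k, (T k).IsSymmetric := fun k => Matrix.isSymmetric_toEuclideanLin_iff.2 (hM k)
  have hC : Pairwise (Function.onFun Commute T) := by
    intro k l _
    change T k * T l = T l * T k
    refine LinearMap.ext fun x => ?_
    have := (hc k l).eq
    simp only [T, Module.End.mul_apply, Matrix.toLpLin_apply, Matrix.mulVec_mulVec, this]
  let E : (κ → ℂ) → Submodule ℂ (EuclideanSpace ℂ ι) :=
    fun χ => ⨅ k, Module.End.eigenspace (T k) (χ k)
  have hint : DirectSum.IsInternal E :=
    LinearMap.IsSymmetric.directSum_isInternal_of_pairwise_commute hT hC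
  have horth := LinearMap.IsSymmetric.orthogonalFamily_iInf_eigenspaces hT
  -- The joint eigenspaces are indexed by all functions `κ → ℂ`, possibly with `κ` infinite. Only
  -- finitely many are nonzero, and a subordinate orthonormal basis needs a finite index.
  have hfin : Finite {χ // E χ ≠ ⊥} :=
    WellFoundedGT.finite_ne_bot_of_iSupIndep hint.submodule_iSupIndep
  have : Fintype {χ // E χ ≠ ⊥} := Fintype.ofFinite _
  have hint' : DirectSum.IsInternal fun χ : {χ // E χ ≠ ⊥} => E χ :=
    (DirectSum.isInternal_ne_bot_iff (A := E)).2 hint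
  have horth' : OrthogonalFamily ℂ (fun χ : {χ // E χ ≠ ⊥} => E χ) fun χ => (E χ).subtypeₗᵢ :=
    horth.comp (f := fun χ : {χ // E χ ≠ ⊥} => (χ : κ → ℂ)) Subtype.val_injective
  have hn : Module.finrank ℂ (EuclideanSpace ℂ ι) = Fintype.card ι := finrank_euclideanSpace
  let b₀ := hint'.subordinateOrthonormalBasis hn horth'
  let e : Fin (Fintype.card ι) ≃ ι := (Fintype.equivFin ι).symm
  let b : OrthonormalBasis ι ℂ (EuclideanSpace ℂ ι) := b₀.reindex e
  let χ' : ι → {χ // E χ ≠ ⊥} := fun i =>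
    hint'.subordinateOrthonormalBasisIndex hn (e.symm i) horth'
  let χ : ι → κ → ℂ := fun i => (χ' i).1
  have hb : ∀ i k, T k (b i) = χ i k • b i := by
    intro i k
    have h := hint'.subordinateOrthonormalBasis_subordinate hn (e.symm i) horth'
    have h2 := (Submodule.mem_iInf _).1 h k
    have h3 := Module.End.mem_eigenspace_iff.1 h2
    simpa [b, b₀, χ, χ'] using h3
  let U : Matrix ι ι ℂ := Matrix.of fun i j => b j i
  have hU : Uᴴ * U = 1 := by
    ext j k
    have h := orthonormal_iff_ite.1 b.orthonormal j k
    rw [Matrix.one_apply, ← h]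
    simp [U, Matrix.mul_apply, PiLp.inner_apply, mul_comm]
  have hU' : U * Uᴴ = 1 := mul_eq_one_comm.1 hU
  have hMU : ∀ k, M k * U = U * Matrix.diagonal (fun i => χ i k) := by
    intro k
    ext i j
    have h := congrArg (fun v : EuclideanSpace ℂ ι => v i) (hb j k)
    simp only [T, Matrix.toLpLin_apply] at h
    rw [Matrix.mul_diagonal, Matrix.mul_apply]
    simpa [U, Matrix.mulVec, dotProduct, mul_comm] using h
  have hMk : ∀ k, M k = U * Matrix.diagonal (fun i => χ i k) * Uᴴ := by
    intro k
    rw [← hMU, Matrix.mul_assoc, hU', Matrix.mul_one]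
  have hreal : ∀ k i, ((χ i k).re : ℂ) = χ i k := by
    intro k i
    have h : Uᴴ * M k * U = Matrix.diagonal (fun i => χ i k) := by
      rw [Matrix.mul_assoc, hMU, ← Matrix.mul_assoc, hU, Matrix.one_mul]
    have h2 : (Uᴴ * M k * U).IsHermitian := Matrix.isHermitian_conjTranspose_mul_mul U (hM k)
    rw [h] at h2
    have h3 := h2.apply i i
    simp only [Matrix.diagonal_apply_eq] at h3
    exact Complex.conj_eq_iff_re.1 h3
  exact ⟨U, hU, hU', fun k i => (χ i k).re, fun k => by simp only [hreal]; exact hMk k⟩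

theorem exists_unitary_diagonal {A : Matrix ι ι ℂ} (hA : A.IsHermitian) :
    ∃ U : Matrix ι ι ℂ, Uᴴ * U = 1 ∧ U * Uᴴ = 1 ∧ ∃ μ : ι → ℝ,
      A = U * Matrix.diagonal (fun i => ((μ i : ℝ) : ℂ)) * Uᴴ := by
  obtain ⟨U, h1, h2, m, hm⟩ := exists_unitary_diagonalizing (fun _ : Unit => A) (fun _ => hA)
    fun _ _ => Commute.refl A
  exact ⟨U, h1, h2, m (), hm ()⟩

theorem mulVec_injective_of_mul_eq_one {U V : Matrix ι ι ℂ} (h : V * U = 1) :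
    Function.Injective U.mulVec :=
  Matrix.mulVec_injective_of_isUnit ⟨⟨U, V, mul_eq_one_comm.1 h, h⟩, rfl⟩

theorem conjTranspose_mul_conj_mul {U : Matrix ι ι ℂ} (hU : Uᴴ * U = 1) (A : Matrix ι ι ℂ) :
    Uᴴ * (U * A * Uᴴ) * U = A := by
  calc Uᴴ * (U * A * Uᴴ) * U = (Uᴴ * U) * A * (Uᴴ * U) := by simp only [Matrix.mul_assoc]
    _ = A := by rw [hU, Matrix.one_mul, Matrix.mul_one]

theorem conj_mul_conj {U : Matrix ι ι ℂ} (hU : Uᴴ * U = 1) (A B : Matrix ι ι ℂ) :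
    (U * A * Uᴴ) * (U * B * Uᴴ) = U * (A * B) * Uᴴ := by
  calc (U * A * Uᴴ) * (U * B * Uᴴ) = U * A * (Uᴴ * U) * (B * Uᴴ) := by
        simp only [Matrix.mul_assoc]
    _ = _ := by rw [hU, Matrix.mul_one]; simp only [Matrix.mul_assoc]

theorem isHermitian_conj_diagonal (U : Matrix ι ι ℂ) (μ : ι → ℝ) :
    (U * Matrix.diagonal (fun i => ((μ i : ℝ) : ℂ)) * Uᴴ).IsHermitian :=
  Matrix.isHermitian_mul_mul_conjTranspose U
    (Matrix.isHermitian_diagonal_of_self_adjoint _ (by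
      ext i
      simp))

/-- The matrix `Wᴴ * V` intertwines the two diagonals, so its entry `(i, j)` vanishes unless `μ j =
ν i`; it then intertwines their images under `f` too. This makes the functional calculus independent
of the chosen eigenbasis. -/
theorem diagonalizing_intertwines {V W : Matrix ι ι ℂ} {μ ν : ι → ℝ} (hV : Vᴴ * V = 1)
    (hW : Wᴴ * W = 1)
    (h : V * Matrix.diagonal (fun i => ((μ i : ℝ) : ℂ)) * Vᴴ
      = W * Matrix.diagonal (fun i => ((ν i : ℝ) : ℂ)) * Wᴴ) (f : ℝ → ℝ) :
    V * Matrix.diagonal (fun i => ((f (μ i) : ℝ) : ℂ)) * Vᴴ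
      = W * Matrix.diagonal (fun i => ((f (ν i) : ℝ) : ℂ)) * Wᴴ := by
  have hV' : V * Vᴴ = 1 := mul_eq_one_comm.1 hV
  have hW' : W * Wᴴ = 1 := mul_eq_one_comm.1 hW
  have key : Wᴴ * V * Matrix.diagonal (fun i => ((μ i : ℝ) : ℂ))
      = Matrix.diagonal (fun i => ((ν i : ℝ) : ℂ)) * (Wᴴ * V) := by
    have h' := congrArg (fun Z => Wᴴ * Z * V) h
    simp only [Matrix.mul_assoc, hV, Matrix.mul_one] at h'
    simp only [← Matrix.mul_assoc, hW, Matrix.one_mul] at h'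
    simpa only [Matrix.mul_assoc] using h'
  have key2 : Wᴴ * V * Matrix.diagonal (fun i => ((f (μ i) : ℝ) : ℂ))
      = Matrix.diagonal (fun i => ((f (ν i) : ℝ) : ℂ)) * (Wᴴ * V) := by
    ext i j
    have h' := congrFun (congrFun key i) j
    rw [Matrix.mul_diagonal, Matrix.diagonal_mul] at h' ⊢
    by_cases hz : (Wᴴ * V) i j = 0
    · simp [hz]
    · have : μ j = ν i := by
        rw [mul_comm] at h'
        exact_mod_cast mul_right_cancel₀ hz h'
      rw [this, mul_comm]
  calc _ = W * (Wᴴ * V * Matrix.diagonal (fun i => ((f (μ i) : ℝ) : ℂ))) * Vᴴ := by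
        rw [← Matrix.mul_assoc, ← Matrix.mul_assoc, hW', Matrix.one_mul]
    _ = W * Matrix.diagonal (fun i => ((f (ν i) : ℝ) : ℂ)) * Wᴴ * (V * Vᴴ) := by
        rw [key2]; simp only [Matrix.mul_assoc]
    _ = _ := by rw [hV', Matrix.mul_one]

/-- The functional calculus in a diagonalizing basis. -/
theorem cfc_conj_diagonal {U : Matrix ι ι ℂ} (hU : Uᴴ * U = 1) (μ : ι → ℝ) (f : ℝ → ℝ) :
    cfc f (U * Matrix.diagonal (fun i => ((μ i : ℝ) : ℂ)) * Uᴴ)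
      = U * Matrix.diagonal (fun i => ((f (μ i) : ℝ) : ℂ)) * Uᴴ := by
  have hA := isHermitian_conj_diagonal U μ
  rw [hA.cfc_eq f, Matrix.IsHermitian.cfc, Unitary.conjStarAlgAut_apply]
  have hW : (hA.eigenvectorUnitary : Matrix ι ι ℂ)ᴴ * (hA.eigenvectorUnitary : Matrix ι ι ℂ) = 1 :=
    Unitary.coe_star_mul_self hA.eigenvectorUnitary
  have h := hA.spectral_theorem
  rw [Unitary.conjStarAlgAut_apply] at h
  exact diagonalizing_intertwines hW hU h.symm f

theorem matrixPow_conj_diagonal {U : Matrix ι ι ℂ} (hU : Uᴴ * U = 1) (μ : ι → ℝ) (s : ℝ) :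
    matrixPow (U * Matrix.diagonal (fun i => ((μ i : ℝ) : ℂ)) * Uᴴ) s
      = U * Matrix.diagonal (fun i => ((μ i ^ s : ℝ) : ℂ)) * Uᴴ :=
  cfc_conj_diagonal hU μ _

theorem posSemidef_conj_diagonal_iff {U : Matrix ι ι ℂ} (hU : Uᴴ * U = 1) {μ : ι → ℝ} :
    (U * Matrix.diagonal (fun i => ((μ i : ℝ) : ℂ)) * Uᴴ).PosSemidef ↔ ∀ i, 0 ≤ μ i := by
  refine ⟨fun h i => ?_, fun h => ?_⟩
  · have h2 := h.conjTranspose_mul_mul_same U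
    rw [conjTranspose_mul_conj_mul hU] at h2
    exact_mod_cast Matrix.posSemidef_diagonal_iff.1 h2 i
  · exact (Matrix.posSemidef_diagonal_iff.2 fun i => by
      exact_mod_cast h i).mul_mul_conjTranspose_same U

theorem posDef_conj_diagonal_pos {U : Matrix ι ι ℂ} (hU : Uᴴ * U = 1) {μ : ι → ℝ}
    (h : (U * Matrix.diagonal (fun i => ((μ i : ℝ) : ℂ)) * Uᴴ).PosDef) (i : ι) : 0 < μ i := by
  have hinj := mulVec_injective_of_mul_eq_one hU
  have h2 := h.conjTranspose_mul_mul_same hinj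
  rw [conjTranspose_mul_conj_mul hU] at h2
  exact_mod_cast Matrix.posDef_diagonal_iff.1 h2 i

theorem exists_unitary_diagonal_posDef {A : Matrix ι ι ℂ} (hA : A.PosDef) :
    ∃ U : Matrix ι ι ℂ, Uᴴ * U = 1 ∧ U * Uᴴ = 1 ∧ ∃ μ : ι → ℝ, (∀ i, 0 < μ i) ∧
      A = U * Matrix.diagonal (fun i => ((μ i : ℝ) : ℂ)) * Uᴴ := by
  obtain ⟨U, h1, h2, μ, rfl⟩ := exists_unitary_diagonal hA.1
  exact ⟨U, h1, h2, μ, posDef_conj_diagonal_pos h1 hA, rfl⟩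

/-- A Hermitian matrix is bounded by the sum of the absolute values of its entries. -/
theorem posSemidef_sum_norm_smul_one_sub {A : Matrix ι ι ℂ} (hA : A.IsHermitian) :
    ((((∑ i, ∑ j, ‖A i j‖ : ℝ) : ℂ) • (1 : Matrix ι ι ℂ)) - A).PosSemidef := by
  obtain ⟨U, h1, h2, μ, rfl⟩ := exists_unitary_diagonal hA
  set A := U * Matrix.diagonal (fun i => ((μ i : ℝ) : ℂ)) * Uᴴ with hAdef
  set N : ℝ := ∑ i, ∑ j, ‖A i j‖
  have hUle : ∀ i j, ‖U i j‖ ≤ 1 := fun i j =>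
    entry_norm_bound_of_unitary (Matrix.mem_unitaryGroup_iff.2 h2) i j
  have hμ : ∀ k, μ k ≤ N := by
    intro k
    -- An eigenvalue is a combination of the entries of `A` whose coefficients are products of two
    -- entries of `U`, each of modulus at most one.
    have h3 : ((μ k : ℝ) : ℂ) = (Uᴴ * A * U) k k := by
      rw [hAdef, conjTranspose_mul_conj_mul h1, Matrix.diagonal_apply_eq]
    calc μ k ≤ ‖((μ k : ℝ) : ℂ)‖ := by rw [Complex.norm_real]; exact le_abs_self _
      _ ≤ ∑ j, ∑ i, ‖A i j‖ := by
        rw [h3, Matrix.mul_apply]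
        refine (norm_sum_le _ _).trans (Finset.sum_le_sum fun j _ => ?_)
        rw [Matrix.mul_apply, Finset.sum_mul]
        refine (norm_sum_le _ _).trans (Finset.sum_le_sum fun i _ => ?_)
        rw [norm_mul, norm_mul, Matrix.conjTranspose_apply, norm_star]
        calc ‖U i k‖ * ‖A i j‖ * ‖U j k‖ ≤ 1 * ‖A i j‖ * 1 := by
              gcongr
              · exact hUle i k
              · exact hUle j k
          _ = _ := by ring
      _ = N := Finset.sum_comm
  have : ((N : ℂ) • (1 : Matrix ι ι ℂ)) - A
      = U * Matrix.diagonal (fun i => ((N - μ i : ℝ) : ℂ)) * Uᴴ := by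
    have hd : Matrix.diagonal (fun i => ((N - μ i : ℝ) : ℂ))
        = (N : ℂ) • (1 : Matrix ι ι ℂ) - Matrix.diagonal (fun i => ((μ i : ℝ) : ℂ)) := by
      rw [Matrix.smul_one_eq_diagonal, Matrix.diagonal_sub]
      push_cast; rfl
    rw [hd, Matrix.mul_sub, Matrix.sub_mul, ← hAdef]
    simp [h2]
  rw [this, posSemidef_conj_diagonal_iff h1]
  exact fun i => sub_nonneg.2 (hμ i)

/-- A positive definite matrix is bounded below by a positive multiple of the identity. -/
theorem exists_one_le_smul_posDef {A : Matrix ι ι ℂ} (hA : A.PosDef) :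
    ∃ C : ℝ, 0 < C ∧ ((C : ℂ) • A - 1).PosSemidef := by
  obtain ⟨U, h1, h2, μ, hμ, rfl⟩ := exists_unitary_diagonal_posDef hA
  have hsum : ∀ i, (μ i)⁻¹ ≤ 1 + ∑ j, (μ j)⁻¹ := fun i =>
    (Finset.single_le_sum (f := fun j => (μ j)⁻¹) (fun j _ => (inv_pos.2 (hμ j)).le)
      (Finset.mem_univ i)).trans (by linarith)
  -- The sum dominates every inverse eigenvalue; the summand `1` keeps `C` positive in dimension
  -- zero.
  set C := 1 + ∑ j, (μ j)⁻¹
  have hC : 0 < C := add_pos_of_pos_of_nonneg one_pos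
    (Finset.sum_nonneg fun j _ => (inv_pos.2 (hμ j)).le)
  refine ⟨C, hC, ?_⟩
  have : (C : ℂ) • (U * Matrix.diagonal (fun i => ((μ i : ℝ) : ℂ)) * Uᴴ) - 1
      = U * Matrix.diagonal (fun i => ((C * μ i - 1 : ℝ) : ℂ)) * Uᴴ := by
    have hd : Matrix.diagonal (fun i => ((C * μ i - 1 : ℝ) : ℂ))
        = (C : ℂ) • Matrix.diagonal (fun i => ((μ i : ℝ) : ℂ)) - 1 := by
      rw [← Matrix.diagonal_one, ← Matrix.diagonal_smul, Matrix.diagonal_sub]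
      push_cast; rfl
    rw [hd, Matrix.mul_sub, Matrix.sub_mul]
    simp [h2]
  rw [this, posSemidef_conj_diagonal_iff h1]
  intro i
  have := mul_le_mul_of_nonneg_right (hsum i) (hμ i).le
  rw [inv_mul_cancel₀ (hμ i).ne'] at this
  linarith

end Diagonalization

/-! ### Aggregates -/

/-- A function `N` of finite families of nonnegative reals that behaves like a power of an `ℓᵖ`
norm: it is monotone, of polynomial growth under scaling, decreasing under doubly stochastic averaging
and multiplicative on tensor powers. -/
structure IsAggregate (N : ∀ (ι : Type) [Fintype ι], (ι → ℝ≥0) → ℝ≥0) (K : ℕ) : Prop where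
  mono : ∀ {ι : Type} [Fintype ι] {v w : ι → ℝ≥0}, (∀ i, v i ≤ w i) → N ι v ≤ N ι w
  nat_mul_le : ∀ {ι : Type} [Fintype ι] (m : ℕ) (v : ι → ℝ≥0),
    N ι (fun i => m * v i) ≤ (m : ℝ≥0) ^ K * N ι v
  average_le : ∀ {ι : Type} [Fintype ι] (W : ι → ι → ℝ≥0) (v : ι → ℝ≥0),
    (∀ i, ∑ j, W i j = 1) → (∀ j, ∑ i, W i j = 1) → N ι (fun i => ∑ j, W i j * v j) ≤ N ι v
  pow : ∀ {ι : Type} [Fintype ι] (n : ℕ) (v : ι → ℝ≥0),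
    N (Fin n → ι) (fun a => ∏ k, v (a k)) = N ι v ^ n

/-- Averaging is Jensen's inequality for the convex `t ↦ t ^ α`: row sums one make it applicable,
column sums one collapse the result. The ceiling only supplies a natural exponent. -/
theorem isAggregate_sum_rpow {α : ℝ} (hα : 1 ≤ α) :
    IsAggregate (fun _ _ v => ∑ i, v i ^ α) ⌈α⌉₊ where
  mono h := Finset.sum_le_sum fun i _ => NNReal.rpow_le_rpow (h i) (by linarith)
  nat_mul_le m v := by
    have hm : ((m : ℝ≥0)) ^ α ≤ (m : ℝ≥0) ^ ⌈α⌉₊ := by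
      rcases Nat.eq_zero_or_pos m with rfl | hm
      · rw [Nat.cast_zero, NNReal.zero_rpow (by linarith)]
        exact zero_le
      · rw [← NNReal.rpow_natCast]
        exact NNReal.rpow_le_rpow_of_exponent_le (by exact_mod_cast hm) (Nat.le_ceil α)
    simp only [NNReal.mul_rpow, ← Finset.mul_sum]
    gcongr
  average_le W v h1 h2 := by
    calc ∑ i, (∑ j, W i j * v j) ^ α ≤ ∑ i, ∑ j, W i j * v j ^ α :=
          Finset.sum_le_sum fun i _ =>
            NNReal.rpow_arith_mean_le_arith_mean_rpow _ _ _ (h1 i) hα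
      _ = ∑ j, (∑ i, W i j) * v j ^ α := by
          rw [Finset.sum_comm]
          simp only [Finset.sum_mul]
      _ = _ := by simp only [h2, one_mul]
  pow n v := by
    simp only [← NNReal.finsetProd_rpow]
    rw [Fintype.sum_pow]

theorem isAggregate_sup : IsAggregate (fun _ _ v => Finset.univ.sup v) 1 where
  mono h := Finset.sup_mono_fun fun i _ => h i
  nat_mul_le m v := by
    refine Finset.sup_le fun i hi => ?_
    rw [pow_one]
    gcongr
    exact Finset.le_sup hi
  average_le W v h1 _ := by
    refine Finset.sup_le fun i _ => ?_
    calc ∑ j, W i j * v j ≤ ∑ j, W i j * Finset.univ.sup v :=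
          Finset.sum_le_sum fun j hj => by gcongr; exact Finset.le_sup hj
      _ = _ := by rw [← Finset.sum_mul, h1, one_mul]
  pow {ι} _ n v := by
    refine le_antisymm (Finset.sup_le fun a _ => ?_) ?_
    · refine (Finset.prod_le_pow_card _ _ _ fun k _ => Finset.le_sup (Finset.mem_univ _)).trans ?_
      simp
    -- With no letters, `n = 0` still leaves one empty word, of product `1 = 0 ^ 0`; for positive
    -- `n` both sides are `0`.
    · rcases isEmpty_or_nonempty ι with h | h
      · rcases n with _ | n
        · rw [pow_zero]
          exact Finset.le_sup_of_le (b := Fin.elim0) (Finset.mem_univ _) (by simp)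
        · simp
      · obtain ⟨i, _, hi⟩ := Finset.exists_mem_eq_sup Finset.univ Finset.univ_nonempty v
        rw [hi]
        exact Finset.le_sup_of_le (b := fun _ => i) (Finset.mem_univ _) (by simp)

/-! ### Majorization of diagonals by eigenvalues -/

section Majorization

variable {N : ∀ (ι : Type) [Fintype ι], (ι → ℝ≥0) → ℝ≥0} {K : ℕ}
  {ι : Type} [Fintype ι] [DecidableEq ι]

theorem sum_nnnorm_sq_row {U : Matrix ι ι ℂ} (hU : U * Uᴴ = 1) (i : ι) :
    ∑ j, ‖U i j‖₊ ^ 2 = 1 := by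
  have h := congrFun (congrFun hU i) i
  rw [Matrix.mul_apply, Matrix.one_apply_eq] at h
  have : ((∑ j, ‖U i j‖ ^ 2 : ℝ) : ℂ) = 1 := by
    rw [← h]
    push_cast
    refine Finset.sum_congr rfl fun j _ => ?_
    rw [Matrix.conjTranspose_apply, RCLike.star_def, Complex.mul_conj, Complex.normSq_eq_norm_sq]
    push_cast; rfl
  apply NNReal.coe_injective
  push_cast
  exact_mod_cast this

/-- The diagonal of a matrix in any orthonormal basis is dominated by its eigenvalues. -/
theorem IsAggregate.diagonal_le (hN : IsAggregate N K) {U V A : Matrix ι ι ℂ} (hU : Uᴴ * U = 1)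
    (hV : Vᴴ * V = 1) {μ b : ι → ℝ≥0}
    (hA : A = U * Matrix.diagonal (fun i => ((μ i : ℝ) : ℂ)) * Uᴴ)
    (hb : ∀ i, (Vᴴ * A * V) i i = ((b i : ℝ) : ℂ)) : N ι b ≤ N ι μ := by
  have hU' : U * Uᴴ = 1 := mul_eq_one_comm.1 hU
  have hV' : V * Vᴴ = 1 := mul_eq_one_comm.1 hV
  set G := Vᴴ * U with hG
  have h1 : G * Gᴴ = 1 := by
    rw [hG, Matrix.conjTranspose_mul, Matrix.conjTranspose_conjTranspose]
    calc Vᴴ * U * (Uᴴ * V) = Vᴴ * (U * Uᴴ) * V := by simp only [Matrix.mul_assoc]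
      _ = 1 := by rw [hU', Matrix.mul_one, hV]
  have h2 : Gᴴ * Gᴴᴴ = 1 := by
    rw [Matrix.conjTranspose_conjTranspose]
    exact mul_eq_one_comm.1 h1
  have hGA : Vᴴ * A * V = G * Matrix.diagonal (fun i => ((μ i : ℝ) : ℂ)) * Gᴴ := by
    rw [hA, hG, Matrix.conjTranspose_mul, Matrix.conjTranspose_conjTranspose]
    simp only [Matrix.mul_assoc]
  -- Schur's argument: the squared moduli of the entries of the unitary `G` form a doubly stochastic
  -- matrix taking the eigenvalues to the diagonal.
  have hbv : b = fun i => ∑ j, ‖G i j‖₊ ^ 2 * μ j := by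
    funext i
    have h := hb i
    rw [hGA, Matrix.mul_apply] at h
    apply NNReal.coe_injective
    apply Complex.ofReal_injective
    rw [← h]
    push_cast
    refine Finset.sum_congr rfl fun j _ => ?_
    rw [Matrix.mul_diagonal, Matrix.conjTranspose_apply, RCLike.star_def, mul_right_comm,
      Complex.mul_conj, Complex.normSq_eq_norm_sq]
    push_cast; rfl
  rw [hbv]
  refine hN.average_le _ _ (sum_nnnorm_sq_row h1) fun j => ?_
  rw [← sum_nnnorm_sq_row h2 j]
  simp [Matrix.conjTranspose_apply]

/-- Eigenvalues are monotone in the sense of aggregates. -/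
theorem IsAggregate.eigenvalues_le (hN : IsAggregate N K) {U V A B : Matrix ι ι ℂ}
    (hU : Uᴴ * U = 1) (hV : Vᴴ * V = 1) {μ b : ι → ℝ≥0}
    (hA : A = U * Matrix.diagonal (fun i => ((μ i : ℝ) : ℂ)) * Uᴴ)
    (hB : B = V * Matrix.diagonal (fun i => ((b i : ℝ) : ℂ)) * Vᴴ) (h : (B - A).PosSemidef) :
    N ι μ ≤ N ι b := by
  -- In an eigenbasis of `A`, the diagonal of `B` dominates the eigenvalues of `A`; by `diagonal_le`
  -- it is in turn dominated by the eigenvalues of `B`.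
  have hle : ∀ i, ((μ i : ℝ) : ℂ) ≤ (Uᴴ * B * U) i i := by
    intro i
    have h2 := (h.conjTranspose_mul_mul_same U).diag_nonneg (i := i)
    rw [Matrix.mul_sub, Matrix.sub_mul, hA, conjTranspose_mul_conj_mul hU, Matrix.sub_apply,
      Matrix.diagonal_apply_eq] at h2
    exact sub_nonneg.1 h2
  have hex : ∀ i, ∃ t : ℝ≥0, (Uᴴ * B * U) i i = ((t : ℝ) : ℂ) := fun i => by
    have h0 : 0 ≤ (Uᴴ * B * U) i i := le_trans (by exact_mod_cast (μ i).2) (hle i)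
    obtain ⟨h3, h4⟩ := Complex.nonneg_iff.1 h0
    exact ⟨⟨_, h3⟩, Complex.ext rfl (by simpa using h4.symm)⟩
  choose t ht using hex
  refine (hN.mono (w := t) fun i => ?_).trans (hN.diagonal_le hV hU hB ht)
  have := hle i
  rw [ht] at this
  exact_mod_cast this

end Majorization

/-! ### Pinching -/

section Pinching

variable {ι κ : Type} [DecidableEq κ]

/-- The pinching of a matrix: its block diagonal part with respect to a coloring of the index. -/
def pinching (c : ι → κ) (A : Matrix ι ι ℂ) : Matrix ι ι ℂ :=
  Matrix.of fun i j => if c i = c j then A i j else 0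

/-- The projection to the basis vectors of a given color. -/
def colorProjection [DecidableEq ι] (c : ι → κ) (k : κ) : Matrix ι ι ℂ :=
  Matrix.diagonal fun i => if c i = k then 1 else 0

theorem colorProjection_isHermitian [DecidableEq ι] (c : ι → κ) (k : κ) :
    (colorProjection c k).IsHermitian :=
  Matrix.isHermitian_diagonal_of_self_adjoint _ (by
    ext i
    by_cases h : c i = k <;> simp [h])

theorem pinching_isHermitian (c : ι → κ) {A : Matrix ι ι ℂ} (hA : A.IsHermitian) :
    (pinching c A).IsHermitian := by
  ext i j
  rw [Matrix.conjTranspose_apply, pinching, Matrix.of_apply, Matrix.of_apply]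
  by_cases h : c i = c j
  · simpa [h] using hA.apply i j
  · simp [h, Ne.symm h]

/-- One entry of `∑ k, ∑ l, (E k - E l) * A * (E k - E l)` for color projections `E`, with `a` and
`b` the colors of the row and the column and `r` the entry of `A`. -/
theorem sum_sum_indicator_sub_mul_indicator_sub [Fintype κ] (a b : κ) (r : ℂ) :
    ∑ k, ∑ l, ((if a = k then (1 : ℂ) else 0) - if a = l then 1 else 0) * r *
        ((if b = k then (1 : ℂ) else 0) - if b = l then 1 else 0)
      = 2 * ((Fintype.card κ : ℂ) * (if a = b then r else 0) - r) := by
  have : ∀ k l : κ, ((if a = k then (1 : ℂ) else 0) - if a = l then 1 else 0) * r *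
      ((if b = k then (1 : ℂ) else 0) - if b = l then 1 else 0)
      = (if b = k then if a = k then r else 0 else 0)
        - (if b = l then if a = k then r else 0 else 0)
        - (if a = l then if b = k then r else 0 else 0)
        + (if b = l then if a = l then r else 0 else 0) := by
    intro k l
    split_ifs <;> ring
  simp only [this, Finset.sum_add_distrib, Finset.sum_sub_distrib,
    Finset.sum_ite_eq, Finset.mem_univ, if_true, Finset.sum_const, Finset.card_univ,
    nsmul_eq_mul]
  simp only [← Finset.mul_sum, Finset.sum_ite_eq, Finset.mem_univ, if_true]
  ring

/-- The pinching inequality. -/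
theorem card_smul_pinching_sub_posSemidef [DecidableEq ι] [Fintype ι] [Fintype κ] (c : ι → κ)
    {A : Matrix ι ι ℂ} (hA : A.PosSemidef) :
    ((Fintype.card κ : ℂ) • pinching c A - A).PosSemidef := by
  have h1 : (∑ k, ∑ l, (colorProjection c k - colorProjection c l) * A *
      (colorProjection c k - colorProjection c l)ᴴ).PosSemidef :=
    Matrix.posSemidef_sum _ fun k _ => Matrix.posSemidef_sum _ fun l _ =>
      hA.mul_mul_conjTranspose_same _
  -- Since the color projections sum to one, the double sum equals twice the left side, which
  -- exhibits it as a sum of conjugates of `A`.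
  have h2 : (Fintype.card κ : ℂ) • pinching c A - A
      = (2⁻¹ : ℂ) • ∑ k, ∑ l, (colorProjection c k - colorProjection c l) * A *
      (colorProjection c k - colorProjection c l)ᴴ := by
    have hE : ∀ k l, (colorProjection c k - colorProjection c l)ᴴ
        = colorProjection c k - colorProjection c l := fun k l =>
      (colorProjection_isHermitian c k).sub (colorProjection_isHermitian c l)
    ext i j
    simp only [hE]
    simp only [Matrix.smul_apply, Matrix.sub_apply, Matrix.sum_apply, colorProjection,
      Matrix.diagonal_sub, Matrix.mul_diagonal, Matrix.diagonal_mul,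
      sum_sum_indicator_sub_mul_indicator_sub, pinching, Matrix.of_apply, smul_eq_mul]
    by_cases h : c i = c j
    · simp only [h, if_true]; ring
    · simp only [h, if_false]; ring
  rw [h2]
  exact h1.smul (inv_nonneg.2 zero_le_two)

theorem pinching_commute_colorProjection [DecidableEq ι] [Fintype ι] (c : ι → κ)
    (A : Matrix ι ι ℂ) (k : κ) :
    Commute (pinching c A) (colorProjection c k) := by
  change _ * _ = _ * _
  ext i j
  rw [colorProjection, Matrix.mul_diagonal, Matrix.diagonal_mul, pinching, Matrix.of_apply]
  by_cases h : c i = c j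
  · simp [h]
  · simp [h]

/-- An orthonormal basis that is compatible with a coloring of the standard basis and diagonalizes
the pinching of a given positive definite matrix. -/
theorem exists_pinching_basis [DecidableEq ι] [Fintype ι] [Fintype κ] (c : ι → κ)
    {R : Matrix ι ι ℂ} (hR : R.PosDef) :
    ∃ (V : Matrix ι ι ℂ) (b : ι → ℝ≥0) (c' : ι → κ), Vᴴ * V = 1 ∧ V * Vᴴ = 1 ∧ (∀ i, 0 < b i) ∧
      (∀ u : κ → ℂ, Matrix.diagonal (fun i => u (c i)) * V
        = V * Matrix.diagonal (fun i => u (c' i))) ∧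
      (∀ i, (Vᴴ * R * V) i i = ((b i : ℝ) : ℂ)) ∧
      ((Fintype.card κ : ℂ) • (V * Matrix.diagonal (fun i => ((b i : ℝ) : ℂ)) * Vᴴ)
        - R).PosSemidef := by
  -- Diagonalizing the pinching together with all color projections forces each basis vector to lie
  -- in a single color block.
  let M : Option κ → Matrix ι ι ℂ := fun o => o.elim (pinching c R) (colorProjection c)
  obtain ⟨V, hV, hV', m, hm⟩ := exists_unitary_diagonalizing M
    (by rintro (_ | k)
        · exact pinching_isHermitian c hR.1
        · exact colorProjection_isHermitian c k)
    (by rintro (_ | k) (_ | l)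
        · exact Commute.refl _
        · exact pinching_commute_colorProjection c R l
        · exact (pinching_commute_colorProjection c R k).symm
        · exact Matrix.commute_diagonal _ _)
  have hcol : ∀ i, ∃ a, V a i ≠ 0 := by
    intro i
    by_contra! h
    have := congrFun (congrFun hV i) i
    rw [Matrix.mul_apply, Matrix.one_apply_eq] at this
    simp [h] at this
  choose a ha using hcol
  have hproj : ∀ k b i, (if c b = k then (1 : ℂ) else 0) * V b i
      = V b i * ((m (some k) i : ℝ) : ℂ) := by
    intro k b i
    have h : colorProjection c k * V = V * Matrix.diagonal fun i => ((m (some k) i : ℝ) : ℂ) := by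
      have := hm (some k)
      change colorProjection c k = _ at this
      rw [this, Matrix.mul_assoc, hV, Matrix.mul_one]
    have h2 := congrFun (congrFun h b) i
    rwa [colorProjection, Matrix.diagonal_mul, Matrix.mul_diagonal] at h2
  have hone : ∀ k b i, V b i ≠ 0 → (if c b = k then (1 : ℂ) else 0) = ((m (some k) i : ℝ) : ℂ) := by
    intro k b i h
    have := hproj k b i
    rw [mul_comm] at this
    exact mul_left_cancel₀ h this
  -- All nonzero entries of column `i` sit at indices of the same color, as each of them reveals the
  -- same eigenvalues of the projections; `c (a i)` becomes the new color `c' i`.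
  have hcolor : ∀ b i, V b i ≠ 0 → c b = c (a i) := by
    intro b i h
    have h1 := (hone (c (a i)) b i h).trans (hone (c (a i)) (a i) i (ha i)).symm
    by_contra hne
    simp [hne] at h1
  -- The entries that pinching removes pair different colors, and a column of `V` never meets two
  -- colors.
  have hdiag : ∀ i, (Vᴴ * R * V) i i = (Vᴴ * pinching c R * V) i i := by
    intro i
    simp only [Matrix.mul_apply, Matrix.conjTranspose_apply, pinching, Matrix.of_apply]
    refine Finset.sum_congr rfl fun j _ => ?_
    by_cases hj : V j i = 0
    · simp [hj]
    congr 1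
    refine Finset.sum_congr rfl fun k _ => ?_
    by_cases hk : V k i = 0
    · simp [hk]
    rw [hcolor j i hj, hcolor k i hk, if_pos rfl]
  have hpinch : pinching c R = V * Matrix.diagonal (fun i => ((m none i : ℝ) : ℂ)) * Vᴴ := hm none
  have hdiag' : ∀ i, (Vᴴ * R * V) i i = ((m none i : ℝ) : ℂ) := by
    intro i
    rw [hdiag, hpinch, conjTranspose_mul_conj_mul hV, Matrix.diagonal_apply_eq]
  have hpos : ∀ i, 0 < m none i := by
    intro i
    have hinj := mulVec_injective_of_mul_eq_one hV
    have := (hR.conjTranspose_mul_mul_same hinj).diag_pos (i := i)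
    rw [hdiag'] at this
    exact_mod_cast this
  refine ⟨V, fun i => ⟨m none i, (hpos i).le⟩, fun i => c (a i), hV, hV', hpos,
    fun u => ?_, hdiag', ?_⟩
  · ext b i
    rw [Matrix.diagonal_mul, Matrix.mul_diagonal, mul_comm]
    by_cases h : V b i = 0
    · simp [h]
    · rw [hcolor b i h]
  · have := card_smul_pinching_sub_posSemidef c hR.posSemidef
    rwa [hpinch] at this

end Pinching

/-! ### Measurements -/

section Measurement

variable {ι : Type} [Fintype ι] [DecidableEq ι]

/-- The measurement in the orthonormal basis given by the columns of `V`. -/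
def measurement (V : Matrix ι ι ℂ) : Matrix ι ι ℂ →ₗ[ℂ] Matrix ι ι ℂ where
  toFun A := Matrix.diagonal fun i => (Vᴴ * A * V) i i
  map_add' A B := by
    rw [Matrix.mul_add, Matrix.add_mul, Matrix.diagonal_add]
    rfl
  map_smul' c A := by
    rw [Matrix.mul_smul, Matrix.smul_mul, RingHom.id_apply, ← Matrix.diagonal_smul]
    rfl

theorem measurement_apply (V A : Matrix ι ι ℂ) :
    measurement V A = Matrix.diagonal fun i => (Vᴴ * A * V) i i := rfl

/-- A Kraus decomposition, from which complete positivity follows. -/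
theorem measurement_eq_sum (V : Matrix ι ι ℂ) :
    measurement V = ∑ i, conjMap (Matrix.single i i (1 : ℂ) * Vᴴ) := by
  refine LinearMap.ext fun A => ?_
  rw [LinearMap.sum_apply]
  have : ∀ i, conjMap (Matrix.single i i (1 : ℂ) * Vᴴ) A
      = Matrix.single i i ((Vᴴ * A * V) i i) := by
    intro i
    change Matrix.single i i (1 : ℂ) * Vᴴ * A * (Matrix.single i i (1 : ℂ) * Vᴴ)ᴴ = _
    rw [Matrix.conjTranspose_mul, Matrix.conjTranspose_conjTranspose, Matrix.conjTranspose_single,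
      star_one]
    calc _ = Matrix.single i i (1 : ℂ) * (Vᴴ * A * V) * Matrix.single i i (1 : ℂ) := by
          simp only [Matrix.mul_assoc]
      _ = _ := by rw [Matrix.single_mul_mul_single, one_mul, mul_one]
  simp only [this, measurement_apply]
  ext k l
  rw [Matrix.sum_apply, Matrix.diagonal_apply]
  by_cases h : k = l
  · subst h
    rw [if_pos rfl, Finset.sum_eq_single k]
    · simp
    · intro b _ hb
      simp [hb]
    · simp
  · rw [if_neg h]
    symm
    refine Finset.sum_eq_zero fun i _ => ?_
    rw [Matrix.single_apply, if_neg]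
    rintro ⟨rfl, rfl⟩
    exact h rfl

theorem IsCompletelyPositive.sum {ι κ τ : Type} [Fintype κ] (s : Finset τ)
    (T : τ → Matrix ι ι ℂ →ₗ[ℂ] Matrix κ κ ℂ) (h : ∀ i ∈ s, IsCompletelyPositive (T i)) :
    IsCompletelyPositive (∑ i ∈ s, T i) := by
  intro n M hM
  have : ampliation (∑ i ∈ s, T i) n M = ∑ i ∈ s, ampliation (T i) n M := by
    ext k l
    simp [ampliation, LinearMap.sum_apply, Matrix.sum_apply]
  rw [this]
  exact Matrix.posSemidef_sum _ fun i hi => h i hi n M hM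

theorem measurement_completelyPositive (V : Matrix ι ι ℂ) :
    IsCompletelyPositive (measurement V) := by
  rw [measurement_eq_sum]
  exact IsCompletelyPositive.sum _ _ fun i _ => conjMap_completelyPositive _

theorem measurement_trace {V : Matrix ι ι ℂ} (hV : V * Vᴴ = 1) (A : Matrix ι ι ℂ) :
    (measurement V A).trace = A.trace := by
  rw [measurement_apply, Matrix.trace_diagonal]
  change (Vᴴ * A * V).trace = _
  rw [Matrix.trace_mul_comm, ← Matrix.mul_assoc, hV, Matrix.one_mul]

theorem measurement_traceNonincreasing {V : Matrix ι ι ℂ} (hV : V * Vᴴ = 1) :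
    IsTraceNonincreasing (measurement V) := fun A _ => by rw [measurement_trace hV]

theorem conjMap_traceNonincreasing {V : Matrix ι ι ℂ} (hV : Vᴴ * V = 1) :
    IsTraceNonincreasing (conjMap V) := fun A _ => by
  change (V * A * Vᴴ).trace.re ≤ _
  rw [Matrix.trace_mul_comm, ← Matrix.mul_assoc, hV, Matrix.one_mul]

end Measurement

/-! ### Direct sums of one-dimensional pairs -/

namespace FamilyPair

variable {X : Type u} {Y : Type v} [TopologicalSpace X] [TopologicalSpace Y]

/-- The pair of families of diagonal matrices given by strictly positive continuous functions. -/
def diagPair {ι : Type} [Fintype ι] [DecidableEq ι] (p : ι → PosFun X) (q : ι → PosFun Y) :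
    FamilyPair X Y where
  ι := ι
  rho x := Matrix.diagonal fun i => (((p i).1 x : ℝ) : ℂ)
  sigma y := Matrix.diagonal fun i => (((q i).1 y : ℝ) : ℂ)
  rho_cont := Continuous.matrix_diagonal
    (continuous_pi fun i => Complex.continuous_ofReal.comp (p i).1.continuous)
  sigma_cont := Continuous.matrix_diagonal
    (continuous_pi fun i => Complex.continuous_ofReal.comp (q i).1.continuous)
  rho_posDef x := Matrix.PosDef.diagonal fun i => by exact_mod_cast (p i).2 x
  sigma_posDef y := Matrix.PosDef.diagonal fun i => by exact_mod_cast (q i).2 y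

/-- Identifies diagonal pairs with the sums of one-dimensional elements on which the restricted
functionals are prescribed. -/
theorem mk_diagPair_fin {d : ℕ} (p : Fin d → PosFun X) (q : Fin d → PosFun Y) :
    FamilySemiring.mk (diagPair p q) = ∑ i, FamilySemiring.oneDim (p i) (q i) := by
  induction d with
  | zero =>
    rw [Finset.univ_eq_empty, Finset.sum_empty]
    exact FamilySemiring.mk_eq_mk.2 (.of_equiv (P := diagPair p q) (Q := zeroPair X Y)
      (Equiv.equivOfIsEmpty (Fin 0) Empty) (fun _ i => Fin.elim0 i) fun _ i => Fin.elim0 i)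
  | succ d ih =>
    rw [Fin.sum_univ_castSucc, ← ih, FamilySemiring.oneDim, FamilySemiring.mk_add_mk]
    symm
    let e : Fin d ⊕ Unit ≃ Fin (d + 1) :=
      (Equiv.sumCongr (Equiv.refl _) (Equiv.ofUnique Unit (Fin 1))).trans finSumFinEquiv
    have h : ∀ v : Fin (d + 1) → ℂ, Matrix.fromBlocks (Matrix.diagonal fun i => v i.castSucc) 0 0
        (Matrix.diagonal fun _ : Unit => v (Fin.last d)) = (Matrix.diagonal v).submatrix e e := by
      intro v
      rw [Matrix.fromBlocks_diagonal, Matrix.submatrix_diagonal _ _ e.injective]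
      congr 1
      funext i
      rcases i with i | i <;> rfl
    exact FamilySemiring.mk_eq_mk.2 (.of_equiv e
      (fun x i j => congrFun (congrFun (h fun i => (((p i).1 x : ℝ) : ℂ)) i) j)
      (fun y i j => congrFun (congrFun (h fun i => (((q i).1 y : ℝ) : ℂ)) i) j))

theorem mk_diagPair_reindex {ι κ : Type} [Fintype ι] [DecidableEq ι] [Fintype κ] [DecidableEq κ]
    (e : κ ≃ ι) (p : ι → PosFun X) (q : ι → PosFun Y) :
    FamilySemiring.mk (diagPair (p ∘ e) (q ∘ e)) = FamilySemiring.mk (diagPair p q) := by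
  have h : ∀ v : ι → ℂ, Matrix.diagonal (v ∘ e) = (Matrix.diagonal v).submatrix e e :=
    fun v => (Matrix.submatrix_diagonal v e e.injective).symm
  exact FamilySemiring.mk_eq_mk.2
    (.of_equiv (P := diagPair (p ∘ e) (q ∘ e)) (Q := diagPair p q) e
      (fun x i j => congrFun (congrFun (h fun i => (((p i).1 x : ℝ) : ℂ)) i) j)
      (fun y i j => congrFun (congrFun (h fun i => (((q i).1 y : ℝ) : ℂ)) i) j))

end FamilyPair

/-! ### Tensor powers -/

section TensorPower

variable {ι : Type}

/-- The `n`-fold tensor power of a matrix. -/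
def tensorPow (A : Matrix ι ι ℂ) (n : ℕ) : Matrix (Fin n → ι) (Fin n → ι) ℂ :=
  Matrix.of fun a b => ∏ k, A (a k) (b k)

theorem tensorPow_apply (A : Matrix ι ι ℂ) (n : ℕ) (a b : Fin n → ι) :
    tensorPow A n a b = ∏ k, A (a k) (b k) := rfl

theorem tensorPow_zero_apply (A : Matrix ι ι ℂ) (a b : Fin 0 → ι) : tensorPow A 0 a b = 1 := by
  rw [tensorPow_apply, Fin.prod_univ_zero]

theorem tensorPow_mul [Fintype ι] [DecidableEq ι] (A B : Matrix ι ι ℂ) (n : ℕ) :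
    tensorPow (A * B) n = tensorPow A n * tensorPow B n := by
  ext a b
  simp only [tensorPow_apply, Matrix.mul_apply, ← Finset.prod_mul_distrib]
  rw [Finset.prod_univ_sum, Fintype.piFinset_univ]

theorem tensorPow_conjTranspose (A : Matrix ι ι ℂ) (n : ℕ) :
    tensorPow Aᴴ n = (tensorPow A n)ᴴ := by
  ext a b
  simp [tensorPow_apply, Matrix.conjTranspose_apply]

theorem tensorPow_diagonal [DecidableEq ι] (v : ι → ℂ) (n : ℕ) :
    tensorPow (Matrix.diagonal v) n = Matrix.diagonal fun a => ∏ k, v (a k) := by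
  ext a b
  rw [tensorPow_apply]
  by_cases h : a = b
  · subst h
    simp
  · rw [Matrix.diagonal_apply_ne _ h]
    obtain ⟨k, hk⟩ := Function.ne_iff.1 h
    exact Finset.prod_eq_zero (Finset.mem_univ k) (Matrix.diagonal_apply_ne _ hk)

theorem tensorPow_one [DecidableEq ι] (n : ℕ) :
    tensorPow (1 : Matrix ι ι ℂ) n = 1 := by
  rw [← Matrix.diagonal_one, tensorPow_diagonal]
  simp

theorem tensorPow_star_mul_self [Fintype ι] [DecidableEq ι] {U : Matrix ι ι ℂ} (hU : Uᴴ * U = 1)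
    (n : ℕ) : (tensorPow U n)ᴴ * tensorPow U n = 1 := by
  rw [← tensorPow_conjTranspose, ← tensorPow_mul, hU, tensorPow_one]

theorem tensorPow_conj_diagonal [Fintype ι] [DecidableEq ι] (U : Matrix ι ι ℂ) (μ : ι → ℝ) (n : ℕ) :
    tensorPow (U * Matrix.diagonal (fun i => ((μ i : ℝ) : ℂ)) * Uᴴ) n
      = tensorPow U n * Matrix.diagonal (fun a => ((∏ k, μ (a k) : ℝ) : ℂ)) * (tensorPow U n)ᴴ := by
  rw [tensorPow_mul, tensorPow_mul, tensorPow_conjTranspose, tensorPow_diagonal]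
  push_cast
  rfl

theorem posDef_conj_diagonal [Fintype ι] [DecidableEq ι] {U : Matrix ι ι ℂ} (hU : U * Uᴴ = 1)
    {μ : ι → ℝ} (hμ : ∀ i, 0 < μ i) :
    (U * Matrix.diagonal (fun i => ((μ i : ℝ) : ℂ)) * Uᴴ).PosDef := by
  have hinj := mulVec_injective_of_mul_eq_one hU
  have hd : (Matrix.diagonal (fun i => ((μ i : ℝ) : ℂ))).PosDef :=
    Matrix.PosDef.diagonal fun i => by exact_mod_cast hμ i
  simpa using hd.conjTranspose_mul_mul_same hinj

theorem tensorPow_posDef [Fintype ι] [DecidableEq ι] {A : Matrix ι ι ℂ} (hA : A.PosDef) (n : ℕ) :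
    (tensorPow A n).PosDef := by
  obtain ⟨U, hU, _, μ, hμ, rfl⟩ := exists_unitary_diagonal_posDef hA
  rw [tensorPow_conj_diagonal]
  exact posDef_conj_diagonal (mul_eq_one_comm.1 (tensorPow_star_mul_self hU n))
    fun a => Finset.prod_pos fun k _ => hμ _

end TensorPower

namespace FamilyPair

variable {X : Type u} {Y : Type v} [TopologicalSpace X] [TopologicalSpace Y]

/-- The `n`-fold tensor power of a pair of families. -/
def powPair (P : FamilyPair X Y) (n : ℕ) : FamilyPair X Y where
  ι := Fin n → P.ι
  rho x := tensorPow (P.rho x) n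
  sigma y := tensorPow (P.sigma y) n
  rho_cont := continuous_matrix fun a b =>
    continuous_finsetProd Finset.univ fun k _ => P.rho_cont.matrix_elem (a k) (b k)
  sigma_cont := continuous_matrix fun a b =>
    continuous_finsetProd Finset.univ fun k _ => P.sigma_cont.matrix_elem (a k) (b k)
  rho_posDef x := tensorPow_posDef (P.rho_posDef x) n
  sigma_posDef y := tensorPow_posDef (P.sigma_posDef y) n

theorem mk_powPair (P : FamilyPair X Y) (n : ℕ) :
    FamilySemiring.mk (powPair P n) = FamilySemiring.mk P ^ n := by
  induction n with
  | zero =>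
    rw [pow_zero]
    refine FamilySemiring.mk_eq_mk.2 (.of_equiv (P := powPair P 0) (Q := onePair X Y)
      (Equiv.ofUnique (Fin 0 → P.ι) Unit) ?_ ?_)
    · exact fun x i j => (tensorPow_zero_apply (P.rho x) i j).trans (Matrix.one_apply_eq ()).symm
    · exact fun y i j => (tensorPow_zero_apply (P.sigma y) i j).trans (Matrix.one_apply_eq ()).symm
  | succ n ih =>
    rw [pow_succ', ← ih, FamilySemiring.mk_mul_mk]
    refine FamilySemiring.mk_eq_mk.2 (.of_equiv (P := powPair P (n + 1))
      (Q := P.tensor (powPair P n)) (Fin.consEquiv fun _ => P.ι).symm ?_ ?_)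
    all_goals
      intro x i j
      exact Fin.prod_univ_succ _

end FamilyPair

theorem posSemidef_sub_of_eq {ι : Type} {A B : Matrix ι ι ℂ} (h : A = B) :
    (A - B).PosSemidef := by
  rw [h, sub_self]
  exact Matrix.PosSemidef.zero

namespace FamilyPair

variable {X : Type u} {Y : Type v} [TopologicalSpace X] [TopologicalSpace Y]

/-- The source of lower bounds: the measurement channel reaches the diagonal pair with equality in
both components. -/
theorem diagPair_le_of_measurement (P : FamilyPair X Y) {V : Matrix P.ι P.ι ℂ}
    (hV : V * Vᴴ = 1) (p : P.ι → PosFun X) (q : P.ι → PosFun Y)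
    (hp : ∀ x i, (Vᴴ * P.rho x * V) i i = (((p i).1 x : ℝ) : ℂ))
    (hq : ∀ y i, (Vᴴ * P.sigma y * V) i i = (((q i).1 y : ℝ) : ℂ)) :
    FamilySemiring.mk (diagPair p q) ≤ FamilySemiring.mk P := by
  have h1 : ∀ x, measurement V (P.rho x) = (diagPair p q).rho x := fun x =>
    congrArg Matrix.diagonal (funext fun i => hp x i)
  have h2 : ∀ y, measurement V (P.sigma y) = (diagPair p q).sigma y := fun y =>
    congrArg Matrix.diagonal (funext fun i => hq y i)
  exact FamilySemiring.mk_le_mk.2 ⟨measurement V, measurement_completelyPositive V,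
    measurement_traceNonincreasing hV, fun x => posSemidef_sub_of_eq (h1 x),
    fun y => posSemidef_sub_of_eq (h2 y).symm⟩

/-- The source of upper bounds: conjugation by `V` recovers `σ` exactly and overshoots `ρ`. -/
theorem le_diagPair (P : FamilyPair X Y) {V : Matrix P.ι P.ι ℂ}
    (hV : Vᴴ * V = 1) (p : P.ι → PosFun X) (q : P.ι → PosFun Y)
    (hp : ∀ x, (V * Matrix.diagonal (fun i => (((p i).1 x : ℝ) : ℂ)) * Vᴴ - P.rho x).PosSemidef)
    (hq : ∀ y, P.sigma y = V * Matrix.diagonal (fun i => (((q i).1 y : ℝ) : ℂ)) * Vᴴ) :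
    FamilySemiring.mk P ≤ FamilySemiring.mk (diagPair p q) := by
  exact FamilySemiring.mk_le_mk.2 ⟨conjMap V, conjMap_completelyPositive V,
    conjMap_traceNonincreasing hV, hp, fun y => posSemidef_sub_of_eq (hq y)⟩

/-- A continuous family of positive definite matrices is dominated by a continuous multiple of
its value at a point, with factor `1` at this point. -/
theorem exists_dominating_factor (P : FamilyPair X Y) (x : X) :
    ∃ h : PosFun X, h.1 x = 1 ∧ ∀ x', (((h.1 x' : ℝ) : ℂ) • P.rho x - P.rho x').PosSemidef := by
  obtain ⟨C, hC, hC1⟩ := exists_one_le_smul_posDef (P.rho_posDef x)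
  let f : X → ℝ := fun x' => ∑ i, ∑ j, ‖(P.rho x' - P.rho x) i j‖
  have hf : Continuous f := continuous_finsetSum _ fun i _ => continuous_finsetSum _ fun j _ =>
    ((P.rho_cont.sub continuous_const).matrix_elem i j).norm
  have hf0 : ∀ x', 0 ≤ f x' := fun x' =>
    Finset.sum_nonneg fun i _ => Finset.sum_nonneg fun j _ => norm_nonneg _
  -- The factor comes from `ρ(x') - ρ(x) ≤ f(x') • 1 ≤ f(x') • C • ρ(x)`, and `f` vanishes at `x`.
  refine ⟨⟨⟨fun x' => 1 + C * f x', by fun_prop⟩, fun x' => ?_⟩, ?_, fun x' => ?_⟩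
  · have := hf0 x'
    change 0 < 1 + C * f x'
    positivity
  · simp [f]
  · have h1 := posSemidef_sum_norm_smul_one_sub ((P.rho_posDef x').1.sub (P.rho_posDef x).1)
    have h2 := hC1.smul (show (0 : ℂ) ≤ ((f x' : ℝ) : ℂ) by exact_mod_cast hf0 x')
    have h3 := h1.add h2
    convert h3 using 1
    change ((1 + C * f x' : ℝ) : ℂ) • P.rho x - P.rho x'
      = (((f x' : ℝ) : ℂ) • 1 - (P.rho x' - P.rho x))
        + ((f x' : ℝ) : ℂ) • ((C : ℂ) • P.rho x - 1)
    push_cast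
    module

end FamilyPair

/-! ### Functionals that are aggregates on classical pairs -/

section Functional

variable {X : Type u} {Y : Type v} [TopologicalSpace X] [TopologicalSpace Y] [MeasurableSpace Y]

/-- The weight `exp ((s / 2) ∫ ln q dγ)`. -/
def expWeight (γ : Measure Y) (s : ℝ) (q : PosFun Y) : ℝ≥0 :=
  ⟨Real.exp (s / 2 * ∫ y, Real.log (q.1 y) ∂γ), (Real.exp_pos _).le⟩

/-- A monotone functional compatible with powers that is given on direct sums of one-dimensional
pairs by the aggregate of `pᵢ(x) exp (s ∫ ln qᵢ dγ)`. -/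
structure IsAggregateFunctional (N : ∀ (ι : Type) [Fintype ι], (ι → ℝ≥0) → ℝ≥0) (s : ℝ) (x : X)
    (γ : Measure Y) (F : FamilySemiring X Y → ℝ≥0) : Prop where
  monotone : Monotone F
  map_pow : ∀ a n, F (a ^ n) = F a ^ n
  map_diagPair : ∀ {ι : Type} [Fintype ι] [DecidableEq ι] (p : ι → PosFun X) (q : ι → PosFun Y),
    F (FamilySemiring.mk (FamilyPair.diagPair p q))
      = N ι fun i => ((p i).1 x).toNNReal * expWeight γ s (q i) ^ 2

variable {N : ∀ (ι : Type) [Fintype ι], (ι → ℝ≥0) → ℝ≥0} {K : ℕ} {s : ℝ} {x : X}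
  {γ : Measure Y} {F : FamilySemiring X Y → ℝ≥0}

/-- Both quantities lie between the value `S` of the pinched classical pair and `card κ ^ K * S`,
hence differ by at most that factor. -/
theorem IsAggregateFunctional.bounds_of_coloring (hF : IsAggregateFunctional N s x γ F)
    (hN : IsAggregate N K) (P : FamilyPair X Y) {κ : Type} [Fintype κ] [DecidableEq κ]
    [Nonempty κ] (c : P.ι → κ) (q : κ → PosFun Y)
    (hσ : ∀ y, P.sigma y = Matrix.diagonal fun i => (((q (c i)).1 y : ℝ) : ℂ))
    {U : Matrix P.ι P.ι ℂ} (hU : Uᴴ * U = 1) {μ : P.ι → ℝ≥0}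
    (hA : Matrix.diagonal (fun i => ((expWeight γ s (q (c i)) : ℝ) : ℂ)) * P.rho x *
      Matrix.diagonal (fun i => ((expWeight γ s (q (c i)) : ℝ) : ℂ))
        = U * Matrix.diagonal (fun i => ((μ i : ℝ) : ℂ)) * Uᴴ) :
    F (FamilySemiring.mk P) ≤ (Fintype.card κ : ℝ≥0) ^ K * N P.ι μ ∧
      N P.ι μ ≤ (Fintype.card κ : ℝ≥0) ^ K * F (FamilySemiring.mk P) := by
  obtain ⟨V, b, c', hV, hV', hb, hcol, hdiag, hle⟩ := exists_pinching_basis c (P.rho_posDef x)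
  have hm : (0 : ℝ) < Fintype.card κ := by exact_mod_cast Fintype.card_pos
  set w : κ → ℝ≥0 := fun k => expWeight γ s (q k) with hw
  set D : Matrix P.ι P.ι ℂ := Matrix.diagonal (fun i => ((w (c i) : ℝ) : ℂ)) with hD
  set D' : Matrix P.ι P.ι ℂ := Matrix.diagonal (fun i => ((w (c' i) : ℝ) : ℂ)) with hD'
  -- The weights depend only on the color, so the basis `V` keeps them diagonal, with `c'` replacing
  -- `c`.
  have hDV : D * V = V * D' := hcol fun k => ((w k : ℝ) : ℂ)
  have hDH : Dᴴ = D := by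
    rw [hD, Matrix.diagonal_conjTranspose]
    congr 1
    funext i
    simp
  have hD'H : D'ᴴ = D' := by
    rw [hD', Matrix.diagonal_conjTranspose]
    congr 1
    funext i
    simp
  have hVD : Vᴴ * D = D' * Vᴴ := by
    have := congrArg Matrix.conjTranspose hDV
    rwa [Matrix.conjTranspose_mul, Matrix.conjTranspose_mul, hDH, hD'H] at this
  have hσV : ∀ y, P.sigma y
      = V * Matrix.diagonal (fun i => (((q (c' i)).1 y : ℝ) : ℂ)) * Vᴴ := by
    intro y
    rw [← hcol fun k => (((q k).1 y : ℝ) : ℂ), Matrix.mul_assoc, hV', Matrix.mul_one, hσ]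
  let S : ℝ≥0 := N P.ι fun i => b i * w (c' i) ^ 2
  have hmS : N P.ι (fun i => (Fintype.card κ : ℝ≥0) * (b i * w (c' i) ^ 2))
      ≤ (Fintype.card κ : ℝ≥0) ^ K * S := hN.nat_mul_le _ _
  have hinj := mulVec_injective_of_mul_eq_one hV
  have hpos : ∀ x' i, 0 < (Vᴴ * P.rho x' * V) i i := fun x' i =>
    ((P.rho_posDef x').conjTranspose_mul_mul_same hinj).diag_pos
  let p : P.ι → PosFun X := fun i => ⟨⟨fun x' => ((Vᴴ * P.rho x' * V) i i).re,
    Complex.continuous_re.comp (((continuous_const.matrix_mul P.rho_cont).matrix_mul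
      continuous_const).matrix_elem i i)⟩, fun x' => (Complex.pos_iff.1 (hpos x' i)).1⟩
  have hp : ∀ x' i, (Vᴴ * P.rho x' * V) i i = (((p i).1 x' : ℝ) : ℂ) := fun x' i =>
    Complex.ext rfl (by simpa using (Complex.pos_iff.1 (hpos x' i)).2.symm)
  have hpb : ∀ i, ((p i).1 x).toNNReal = b i := by
    intro i
    have : (p i).1 x = b i := by
      have := (hp x i).symm.trans (hdiag i)
      exact_mod_cast this
    rw [this, Real.toNNReal_coe]
  have hSF : S ≤ F (FamilySemiring.mk P) := by
    have h1 := hF.monotone (P.diagPair_le_of_measurement hV' p (fun i => q (c' i)) hp fun y i => by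
      rw [hσV, conjTranspose_mul_conj_mul hV, Matrix.diagonal_apply_eq])
    rw [hF.map_diagPair] at h1
    simpa only [hpb] using h1
  have hFS : F (FamilySemiring.mk P) ≤ (Fintype.card κ : ℝ≥0) ^ K * S := by
    obtain ⟨h, hx, hdom⟩ := P.exists_dominating_factor x
    -- The factor `card κ` pays for pinching at `x`, and `h` extends the domination to every other
    -- point without changing the value at `x`.
    let p' : P.ι → PosFun X := fun i => ⟨⟨fun x' => Fintype.card κ * b i * h.1 x', by fun_prop⟩,
      fun x' => mul_pos (mul_pos hm (hb i)) (h.2 x')⟩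
    have h1 := hF.monotone (P.le_diagPair hV p' (fun i => q (c' i)) (fun x' => ?_) hσV)
    · rw [hF.map_diagPair] at h1
      refine h1.trans (le_trans (le_of_eq ?_) hmS)
      congr 1
      funext i
      have : ((p' i).1 x).toNNReal = Fintype.card κ * b i := by
        change ((Fintype.card κ : ℝ) * b i * h.1 x).toNNReal = _
        rw [hx, mul_one, ← NNReal.coe_natCast, ← NNReal.coe_mul, Real.toNNReal_coe]
      rw [this, mul_assoc]
    · have h2 := (hdom x').add (hle.smul (show (0 : ℂ) ≤ ((h.1 x' : ℝ) : ℂ) by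
        exact_mod_cast (h.2 x').le))
      convert h2 using 1
      have : Matrix.diagonal (fun i => (((p' i).1 x' : ℝ) : ℂ))
          = ((h.1 x' : ℝ) : ℂ) • (Fintype.card κ : ℂ) •
            Matrix.diagonal (fun i => ((b i : ℝ) : ℂ)) := by
        rw [← Matrix.diagonal_smul, ← Matrix.diagonal_smul]
        congr 1
        funext i
        change (((Fintype.card κ : ℝ) * b i * h.1 x' : ℝ) : ℂ) = _
        simp only [Pi.smul_apply, smul_eq_mul]
        push_cast
        ring
      rw [this, Matrix.mul_smul, Matrix.mul_smul, Matrix.smul_mul, Matrix.smul_mul]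
      module
  have hbw : ∀ t : ℂ, D * (t • (V * Matrix.diagonal (fun i => ((b i : ℝ) : ℂ)) * Vᴴ)) * D
      = V * Matrix.diagonal (fun i => t * ((b i * w (c' i) ^ 2 : ℝ≥0) : ℝ)) * Vᴴ := by
    intro t
    calc _ = t • ((D * V) * Matrix.diagonal (fun i => ((b i : ℝ) : ℂ)) * (Vᴴ * D)) := by
          simp only [Matrix.mul_smul, Matrix.smul_mul, Matrix.mul_assoc]
      _ = V * (t • (D' * Matrix.diagonal (fun i => ((b i : ℝ) : ℂ)) * D')) * Vᴴ := by
          rw [hDV, hVD]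
          simp only [Matrix.mul_smul, Matrix.smul_mul, Matrix.mul_assoc]
      _ = _ := by
          rw [hD', Matrix.diagonal_mul_diagonal, Matrix.diagonal_mul_diagonal,
            ← Matrix.diagonal_smul]
          congr 3
          funext i
          simp only [Pi.smul_apply, smul_eq_mul]
          push_cast
          ring
  -- The numbers in `S` are the diagonal of `D ρ(x) D` in the basis `V`.
  have hSμ : S ≤ N P.ι μ := by
    refine hN.diagonal_le hU hV hA fun i => ?_
    have : Vᴴ * (D * P.rho x * D) * V = D' * (Vᴴ * P.rho x * V) * D' := by
      calc _ = (Vᴴ * D) * P.rho x * (D * V) := by simp only [Matrix.mul_assoc]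
        _ = _ := by rw [hDV, hVD]; simp only [Matrix.mul_assoc]
    rw [this, hD', Matrix.mul_diagonal, Matrix.diagonal_mul, hdiag]
    push_cast
    ring
  -- The pinching inequality conjugated by `D`; its upper side is already diagonal in `V`.
  have hμS : N P.ι μ ≤ (Fintype.card κ : ℝ≥0) ^ K * S := by
    refine le_trans (hN.eigenvalues_le (A := D * P.rho x * D)
      (B := D * ((Fintype.card κ : ℂ) • (V * Matrix.diagonal (fun i => ((b i : ℝ) : ℂ)) * Vᴴ)) * D)
      hU hV hA ?_ ?_) hmS
    · rw [hbw]
      congr 3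
      funext i
      push_cast
      rfl
    · rw [← Matrix.sub_mul, ← Matrix.mul_sub]
      simpa only [hDH] using hle.mul_mul_conjTranspose_same D
  exact ⟨hFS.trans (by gcongr), hμS.trans (by gcongr)⟩

/-- If `b < a`, the powers of `a / b` would outgrow every polynomial. -/
theorem le_of_pow_le_polynomial_mul_pow {a b : ℝ≥0} {L : ℕ}
    (h : ∀ n : ℕ, a ^ n ≤ ((n : ℝ≥0) + 1) ^ L * b ^ n) : a ≤ b := by
  by_contra! hlt
  rcases eq_or_ne b 0 with rfl | hb
  · have := h 1
    simp at this
    exact hlt.ne' this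
  have hr : 1 < (a / b : ℝ) := by
    rw [one_lt_div (by exact_mod_cast pos_iff_ne_zero.2 hb)]
    exact_mod_cast hlt
  have hlim := tendsto_pow_const_div_const_pow_of_one_lt L hr
  have hlim' := (Filter.tendsto_add_atTop_iff_nat 1).2 hlim
  have hr0 : (0 : ℝ) < a / b := one_pos.trans hr
  -- The sequence is shifted to `n + 1`, so the threshold `(a / b)⁻¹` turns the bound into `(n + 1)
  -- ^ L < (a / b) ^ n`.
  obtain ⟨n, hn⟩ := (hlim'.eventually_lt_const (u := (a / b : ℝ)⁻¹) (inv_pos.2 hr0)).exists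
  rw [div_lt_iff₀ (pow_pos hr0 _), pow_succ', ← mul_assoc, inv_mul_cancel₀ hr0.ne', one_mul,
    div_pow, lt_div_iff₀ (pow_pos (by exact_mod_cast pos_iff_ne_zero.2 hb) _)] at hn
  have := h n
  refine absurd hn (not_lt.2 ?_)
  push_cast
  exact_mod_cast this

variable [CompactSpace Y] [BorelSpace Y]

theorem PosFun.integrable_log [IsFiniteMeasure γ] (q : PosFun Y) :
    Integrable (fun y => Real.log (q.1 y)) γ := by
  have hc : Continuous fun y => Real.log (q.1 y) := q.1.continuous.log fun y => (q.2 y).ne'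
  exact hc.integrable_of_hasCompactSupport (HasCompactSupport.of_compactSpace _)

/-- Weights are multiplicative since `ln` is additive and the integral linear; this makes the matrix
`D` compatible with tensor powers. -/
theorem expWeight_eq_prod [IsFiniteMeasure γ] {τ : Type} (S : Finset τ) (q : τ → PosFun Y)
    (r : PosFun Y) (hr : ∀ y, r.1 y = ∏ i ∈ S, (q i).1 y) :
    expWeight γ s r = ∏ i ∈ S, expWeight γ s (q i) := by
  apply NNReal.coe_injective
  rw [NNReal.coe_prod]
  change Real.exp _ = ∏ i ∈ S, Real.exp _
  rw [← Real.exp_sum, ← Finset.mul_sum, ← integral_finsetSum]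
  · congr 3
    funext y
    rw [hr, Real.log_prod fun i _ => ((q i).2 y).ne']
  · exact fun i _ => PosFun.integrable_log (q i)

/-- An aggregate functional is determined on pairs with diagonal second component. -/
theorem IsAggregateFunctional.eq_of_diagonal [IsFiniteMeasure γ]
    (hF : IsAggregateFunctional N s x γ F)
    (hN : IsAggregate N K) (P : FamilyPair X Y) (q : P.ι → PosFun Y)
    (hσ : ∀ y, P.sigma y = Matrix.diagonal fun i => (((q i).1 y : ℝ) : ℂ))
    {U : Matrix P.ι P.ι ℂ} (hU : Uᴴ * U = 1) {μ : P.ι → ℝ≥0}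
    (hA : Matrix.diagonal (fun i => ((expWeight γ s (q i) : ℝ) : ℂ)) * P.rho x *
      Matrix.diagonal (fun i => ((expWeight γ s (q i) : ℝ) : ℂ))
        = U * Matrix.diagonal (fun i => ((μ i : ℝ) : ℂ)) * Uᴴ) :
    F (FamilySemiring.mk P) = N P.ι μ := by
  have key : ∀ n : ℕ, F (FamilySemiring.mk P) ^ n
        ≤ ((n : ℝ≥0) + 1) ^ (Fintype.card P.ι * K) * N P.ι μ ^ n ∧
      N P.ι μ ^ n ≤ ((n : ℝ≥0) + 1) ^ (Fintype.card P.ι * K) * F (FamilySemiring.mk P) ^ n := by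
    intro n
    -- The color of a word is its type, the number of occurrences of each letter. Diagonal entries
    -- of the tensor power of `σ` depend only on it, and `qn` is the corresponding monomial.
    let c : (Fin n → P.ι) → (P.ι → Fin (n + 1)) := fun a i =>
      ⟨(Finset.univ.filter fun k => a k = i).card, Nat.lt_succ_of_le
        ((Finset.card_le_univ _).trans (Fintype.card_fin n).le)⟩
    let qn : (P.ι → Fin (n + 1)) → PosFun Y := fun t =>
      ⟨⟨fun y => ∏ i, (q i).1 y ^ (t i : ℕ), by fun_prop⟩,
        fun y => Finset.prod_pos fun i _ => pow_pos ((q i).2 y) _⟩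
    have hqn : ∀ a y, (qn (c a)).1 y = ∏ k, (q (a k)).1 y := by
      intro a y
      rw [← Finset.prod_fiberwise' Finset.univ a fun i => (q i).1 y]
      simp only [Finset.prod_const]
      rfl
    have hw : ∀ a, expWeight γ s (qn (c a)) = ∏ k, expWeight γ s (q (a k)) := fun a =>
      expWeight_eq_prod _ (fun k => q (a k)) _ (hqn a)
    have hD : Matrix.diagonal (fun a => ((expWeight γ s (qn (c a)) : ℝ) : ℂ))
        = tensorPow (Matrix.diagonal (fun i => ((expWeight γ s (q i) : ℝ) : ℂ))) n := by
      rw [tensorPow_diagonal]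
      congr 1
      funext a
      rw [hw]
      push_cast
      rfl
    have hAn : Matrix.diagonal (fun a => ((expWeight γ s (qn (c a)) : ℝ) : ℂ)) *
        tensorPow (P.rho x) n * Matrix.diagonal (fun a => ((expWeight γ s (qn (c a)) : ℝ) : ℂ))
          = tensorPow U n * Matrix.diagonal (fun a => (((∏ k, μ (a k) : ℝ≥0) : ℝ) : ℂ)) *
            (tensorPow U n)ᴴ := by
      rw [hD, ← tensorPow_mul, ← tensorPow_mul, hA, tensorPow_conj_diagonal]
      push_cast
      rfl
    have h := hF.bounds_of_coloring hN (P.powPair n) c qn (fun y => ?_)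
      (tensorPow_star_mul_self hU n) hAn
    · rw [FamilyPair.mk_powPair, hF.map_pow] at h
      have hcard : ((Fintype.card (P.ι → Fin (n + 1)) : ℕ) : ℝ≥0) ^ K
          = ((n : ℝ≥0) + 1) ^ (Fintype.card P.ι * K) := by
        rw [Fintype.card_fun, Fintype.card_fin, pow_mul]
        push_cast
        rfl
      have hpow := hN.pow n μ
      rw [hcard] at h
      rw [← hpow]
      exact h
    · change tensorPow (P.sigma y) n = _
      rw [hσ, tensorPow_diagonal]
      congr 1
      funext a
      rw [hqn]
      push_cast
      rfl
  exact le_antisymm (le_of_pow_le_polynomial_mul_pow fun n => (key n).1)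
    (le_of_pow_le_polynomial_mul_pow fun n => (key n).2)

end Functional

/-! ### The quantum functionals in terms of eigenvalues -/

section OperatorNorm

variable {ι : Type} [Fintype ι] [DecidableEq ι]

-- By the C*-identity both sides are the squared norm of `A`.
open scoped Matrix.Norms.L2Operator in
theorem operatorNorm_mul_conjTranspose_self (A : Matrix ι ι ℂ) :
    operatorNorm (A * Aᴴ) = operatorNorm (Aᴴ * A) := by
  change ‖A * star A‖ = ‖star A * A‖
  rw [CStarRing.norm_self_mul_star, CStarRing.norm_star_mul_self]

open scoped Matrix.Norms.L2Operator in
theorem operatorNorm_conj_diagonal {U : Matrix ι ι ℂ} (hU : Uᴴ * U = 1) (μ : ι → ℝ≥0) :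
    operatorNorm (U * Matrix.diagonal (fun i => ((μ i : ℝ) : ℂ)) * Uᴴ)
      = (Finset.univ.sup μ : ℝ≥0) := by
  have hU' : U * Uᴴ = 1 := mul_eq_one_comm.1 hU
  let W : unitary (Matrix ι ι ℂ) := ⟨U, Unitary.mem_iff.2 ⟨hU, hU'⟩⟩
  change ‖(W : Matrix ι ι ℂ) * Matrix.diagonal (fun i => ((μ i : ℝ) : ℂ)) *
    ((star W : unitary (Matrix ι ι ℂ)) : Matrix ι ι ℂ)‖ = _
  rw [CStarRing.norm_mul_coe_unitary, CStarRing.norm_coe_unitary_mul, Matrix.l2_opNorm_diagonal,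
    ← coe_nnnorm, Pi.nnnorm_def]
  congr 2
  funext i
  apply NNReal.coe_injective
  simp

end OperatorNorm

theorem sandwichedQuasiEntropy_eq_sum {ι : Type} [Fintype ι] [DecidableEq ι] {α : ℝ}
    {ρ σ W : Matrix ι ι ℂ} (hW : Wᴴ * W = 1) {μ : ι → ℝ≥0}
    (h : matrixPow σ ((1 - α) / (2 * α)) * ρ * matrixPow σ ((1 - α) / (2 * α))
      = W * Matrix.diagonal (fun i => ((μ i : ℝ) : ℂ)) * Wᴴ) :
    sandwichedQuasiEntropy α ρ σ = (∑ i, μ i ^ α : ℝ≥0) := by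
  rw [sandwichedQuasiEntropy, h, matrixPow_conj_diagonal hW, Matrix.trace_mul_comm,
    ← Matrix.mul_assoc, hW, Matrix.one_mul, Matrix.trace_diagonal, ← Complex.ofReal_sum,
    Complex.ofReal_re]
  push_cast
  rfl

/-! ### The geometric mean `exp ∫ ln σ dγ` of a diagonalized family -/

section ExpIntLog

variable {Y : Type v} [TopologicalSpace Y] [CompactSpace Y] [MeasurableSpace Y] [BorelSpace Y]
  {γ : Measure Y} {ι : Type} [Fintype ι] [DecidableEq ι]

/-- The basis `V` does not depend on `y`, so logarithm, integral and exponential all act on the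
eigenvalues. -/
theorem expIntLog_conj_diagonal [IsFiniteMeasure γ] {V : Matrix ι ι ℂ} (hV : Vᴴ * V = 1)
    (q : ι → PosFun Y) :
    expIntLog γ (fun y => V * Matrix.diagonal (fun i => (((q i).1 y : ℝ) : ℂ)) * Vᴴ)
      = V * Matrix.diagonal
        (fun i => ((Real.exp (∫ y, Real.log ((q i).1 y) ∂γ) : ℝ) : ℂ)) * Vᴴ := by
  have hV' : V * Vᴴ = 1 := mul_eq_one_comm.1 hV
  have hint : (Matrix.of fun i j => ∫ y, (cfc Real.log
      (V * Matrix.diagonal (fun i => (((q i).1 y : ℝ) : ℂ)) * Vᴴ)) i j ∂γ)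
      = V * Matrix.diagonal (fun i => ((∫ y, Real.log ((q i).1 y) ∂γ : ℝ) : ℂ)) * Vᴴ := by
    ext i j
    rw [Matrix.of_apply, Matrix.mul_apply]
    simp only [cfc_conj_diagonal hV, Matrix.mul_apply (N := Vᴴ), Matrix.mul_diagonal]
    rw [integral_finsetSum]
    · refine Finset.sum_congr rfl fun k _ => ?_
      rw [integral_mul_const, integral_const_mul]
      exact congrArg (fun z => V i k * z * Vᴴ k j) integral_ofReal
    · intro k _
      exact ((PosFun.integrable_log (q k)).ofReal.const_mul _).mul_const _
  have hinv : V⁻¹ = Vᴴ := Matrix.inv_eq_right_inv hV'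
  have hunit : IsUnit V := ⟨⟨V, Vᴴ, hV', hV⟩, rfl⟩
  rw [expIntLog, hint, ← hinv, Matrix.exp_conj _ _ hunit, Matrix.exp_diagonal]
  congr 3
  funext i
  rw [Pi.coe_exp, ← Complex.exp_eq_exp_ℂ, Complex.ofReal_exp]

end ExpIntLog

/-! ### Reduction of commuting families to diagonal ones -/

section Commuting

variable {X : Type u} {Y : Type v} [TopologicalSpace X] [TopologicalSpace Y]

theorem FamilyPair.exists_diagonalizing_of_commute (P : FamilyPair X Y)
    (hcomm : ∀ y y' : Y, Commute (P.sigma y) (P.sigma y')) :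
    ∃ V : Matrix P.ι P.ι ℂ, Vᴴ * V = 1 ∧ ∃ q : P.ι → PosFun Y,
      ∀ y, P.sigma y = V * Matrix.diagonal (fun i => (((q i).1 y : ℝ) : ℂ)) * Vᴴ := by
  obtain ⟨V, hV, hV', m, hm⟩ :=
    exists_unitary_diagonalizing P.sigma (fun y => (P.sigma_posDef y).1) hcomm
  have hmV : ∀ y i, (Vᴴ * P.sigma y * V) i i = ((m y i : ℝ) : ℂ) := fun y i => by
    rw [hm, conjTranspose_mul_conj_mul hV, Matrix.diagonal_apply_eq]
  -- With one basis for all `y`, each eigenvalue is a fixed diagonal entry of a continuous matrix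
  -- function.
  have hcont : ∀ i, Continuous fun y => m y i := by
    intro i
    have h : (fun y => m y i) = fun y => ((Vᴴ * P.sigma y * V) i i).re := by
      funext y
      rw [hmV, Complex.ofReal_re]
    rw [h]
    exact Complex.continuous_re.comp (((continuous_const.matrix_mul P.sigma_cont).matrix_mul
      continuous_const).matrix_elem i i)
  exact ⟨V, hV, fun i => ⟨⟨fun y => m y i, hcont i⟩, fun y =>
    posDef_conj_diagonal_pos hV (hm y ▸ P.sigma_posDef y) i⟩, hm⟩

/-- The pair of families in the orthonormal basis given by the columns of `V`. -/
def FamilyPair.conj (P : FamilyPair X Y) (V : Matrix P.ι P.ι ℂ) (hV : V * Vᴴ = 1) :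
    FamilyPair X Y where
  ι := P.ι
  rho x := Vᴴ * P.rho x * V
  sigma y := Vᴴ * P.sigma y * V
  rho_cont := (continuous_const.matrix_mul P.rho_cont).matrix_mul continuous_const
  sigma_cont := (continuous_const.matrix_mul P.sigma_cont).matrix_mul continuous_const
  rho_posDef x := (P.rho_posDef x).conjTranspose_mul_mul_same
    (mulVec_injective_of_mul_eq_one (mul_eq_one_comm.1 hV))
  sigma_posDef y := (P.sigma_posDef y).conjTranspose_mul_mul_same
    (mulVec_injective_of_mul_eq_one (mul_eq_one_comm.1 hV))

theorem FamilyPair.mk_conj (P : FamilyPair X Y) (V : Matrix P.ι P.ι ℂ) (hV : V * Vᴴ = 1) :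
    FamilySemiring.mk (P.conj V hV) = FamilySemiring.mk P := by
  have h : ∀ A, Vᴴ * A * Vᴴᴴ = Vᴴ * A * V := fun A => by rw [Matrix.conjTranspose_conjTranspose]
  have h1 : Vᴴᴴ * Vᴴ = 1 := by rw [Matrix.conjTranspose_conjTranspose, hV]
  exact (FamilySemiring.mk_eq_mk (P := P) (Q := P.conj V hV).2
    ⟨Vᴴ, h1, mul_eq_one_comm.1 h1, fun x => h (P.rho x), fun y => h (P.sigma y)⟩).symm

variable [CompactSpace Y] [MeasurableSpace Y] [BorelSpace Y]
  {N : ∀ (ι : Type) [Fintype ι], (ι → ℝ≥0) → ℝ≥0} {K : ℕ} {s : ℝ} {x : X}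
  {γ : Measure Y} {F : FamilySemiring X Y → ℝ≥0}

/-- A joint eigenbasis of `σ` reduces this to `eq_of_diagonal`, and `F` does not see the unitary
change. Returning a diagonalization of the sandwiched matrix lets its trace power and its norm be
read off alike. -/
theorem IsAggregateFunctional.eq_of_commute [IsFiniteMeasure γ]
    (hF : IsAggregateFunctional N s x γ F) (hN : IsAggregate N K) (P : FamilyPair X Y)
    (hcomm : ∀ y y' : Y, Commute (P.sigma y) (P.sigma y')) :
    ∃ W : Matrix P.ι P.ι ℂ, Wᴴ * W = 1 ∧ ∃ μ : P.ι → ℝ≥0,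
      matrixPow (expIntLog γ P.sigma) (s / 2) * P.rho x * matrixPow (expIntLog γ P.sigma) (s / 2)
        = W * Matrix.diagonal (fun i => ((μ i : ℝ) : ℂ)) * Wᴴ ∧
      F (FamilySemiring.mk P) = N P.ι μ := by
  obtain ⟨V, hV, q, hq⟩ := P.exists_diagonalizing_of_commute hcomm
  have hV' : V * Vᴴ = 1 := mul_eq_one_comm.1 hV
  set D : Matrix P.ι P.ι ℂ := Matrix.diagonal (fun i => ((expWeight γ s (q i) : ℝ) : ℂ)) with hD
  have hZ : matrixPow (expIntLog γ P.sigma) (s / 2) = V * D * Vᴴ := by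
    rw [funext hq, expIntLog_conj_diagonal hV, matrixPow_conj_diagonal hV]
    congr 3
    funext i
    rw [← Real.exp_mul, mul_comm]
    rfl
  have hZH : (V * D * Vᴴ)ᴴ = V * D * Vᴴ :=
    isHermitian_conj_diagonal V fun i => (expWeight γ s (q i) : ℝ)
  have hpsd : (V * D * Vᴴ * P.rho x * (V * D * Vᴴ)).PosSemidef := by
    have := (P.rho_posDef x).posSemidef.mul_mul_conjTranspose_same (V * D * Vᴴ)
    rwa [hZH] at this
  obtain ⟨W, hW, hW', m, hm⟩ := exists_unitary_diagonal hpsd.1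
  have hm0 : ∀ i, 0 ≤ m i := (posSemidef_conj_diagonal_iff hW).1 (hm ▸ hpsd)
  refine ⟨W, hW, fun i => ⟨m i, hm0 i⟩, by rw [hZ]; exact hm, ?_⟩
  rw [← P.mk_conj V hV']
  have hVW : (Vᴴ * W)ᴴ * (Vᴴ * W) = 1 := by
    rw [Matrix.conjTranspose_mul, Matrix.conjTranspose_conjTranspose]
    calc Wᴴ * V * (Vᴴ * W) = Wᴴ * (V * Vᴴ) * W := by simp only [Matrix.mul_assoc]
      _ = 1 := by rw [hV', Matrix.mul_one, hW]
  refine hF.eq_of_diagonal hN (P.conj V hV') q (fun y => ?_) hVW ?_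
  · change Vᴴ * P.sigma y * V = _
    rw [hq, conjTranspose_mul_conj_mul hV]
    rfl
  · change D * (Vᴴ * P.rho x * V) * D
      = Vᴴ * W * Matrix.diagonal (fun i => ((m i : ℝ) : ℂ)) * (Vᴴ * W)ᴴ
    calc D * (Vᴴ * P.rho x * V) * D
        = (Vᴴ * V) * D * (Vᴴ * P.rho x * V) * D * (Vᴴ * V) := by
          rw [hV, Matrix.one_mul, Matrix.mul_one]
      _ = Vᴴ * (V * D * Vᴴ * P.rho x * (V * D * Vᴴ)) * V := by simp only [Matrix.mul_assoc]
      _ = _ := by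
          rw [hm, Matrix.conjTranspose_mul, Matrix.conjTranspose_conjTranspose]
          simp only [Matrix.mul_assoc]

end Commuting

/-! ### Spectral points as aggregate functionals -/

section SpectralPoints

variable {X : Type u} {Y : Type v} [TopologicalSpace X] [TopologicalSpace Y]

theorem FamilyPair.mk_diagPair_eq_classicalSum {ι : Type} [Fintype ι] [DecidableEq ι]
    (p : ι → PosFun X) (q : ι → PosFun Y) (e : Fin (Fintype.card ι) ≃ ι) :
    FamilySemiring.mk (FamilyPair.diagPair p q)
      = (FamilySemiring.classicalSum (p ∘ e) (q ∘ e) : FamilySemiring X Y) := by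
  rw [← mk_diagPair_reindex e, mk_diagPair_fin]
  rfl

variable [MeasurableSpace Y]

theorem expWeight_sq (γ : Measure Y) (s : ℝ) (q : PosFun Y) :
    ((expWeight γ s q ^ 2 : ℝ≥0) : ℝ) = Real.exp (s * ∫ y, Real.log (q.1 y) ∂γ) := by
  rw [NNReal.coe_pow]
  change Real.exp _ ^ 2 = _
  rw [← Real.exp_nat_mul]
  congr 1
  push_cast
  ring

/-- The exponent `(1 - α) / α` is the one whose weight, raised to the power `α`, becomes `exp ((1 -
α) * ∫ ln q dγ)`. -/
theorem isAggregateFunctional_of_isClassicalReal {f : FamilySemiring X Y →+* ℝ≥0}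
    (hf : Monotone f) {α : ℝ} (hα : 1 ≤ α) {x : X} {γ : Measure Y}
    (h : IsClassicalReal (f.domRestrict (FamilySemiring.classical X Y)) α x γ) :
    IsAggregateFunctional (fun _ _ v => ∑ i, v i ^ α) ((1 - α) / α) x γ f where
  monotone := hf
  map_pow a n := _root_.map_pow f a n
  map_diagPair {ι} _ _ p q := by
    let e : Fin (Fintype.card ι) ≃ ι := (Fintype.equivFin ι).symm
    rw [FamilyPair.mk_diagPair_eq_classicalSum p q e]
    refine (h _ (p ∘ e) (q ∘ e)).trans ?_
    rw [← e.sum_comp]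
    refine Finset.sum_congr rfl fun i _ => ?_
    have hp := ((p (e i)).2 x).le
    simp only [Function.comp_apply]
    rw [NNReal.mul_rpow, Real.toNNReal_mul (Real.rpow_nonneg hp _),
      ← Real.toNNReal_rpow_of_nonneg hp]
    congr 1
    apply NNReal.coe_injective
    rw [NNReal.coe_rpow, expWeight_sq, Real.coe_toNNReal _ (Real.exp_pos _).le, ← Real.exp_mul]
    congr 1
    have : α ≠ 0 := by linarith
    rw [mul_right_comm, div_mul_cancel₀ _ this]

theorem TropicalReal.toNNReal_pow (a : TropicalReal) (n : ℕ) :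
    (a ^ n).toNNReal = a.toNNReal ^ n := by
  induction n with
  | zero => rfl
  | succ n ih =>
    rw [pow_succ, pow_succ, ← ih]
    rfl

theorem isAggregateFunctional_of_isClassicalTropical {g : FamilySemiring X Y →+* TropicalReal}
    (hg : Monotone g) {x : X} {γ : Measure Y}
    (h : IsClassicalTropical (g.domRestrict (FamilySemiring.classical X Y)) x γ) :
    IsAggregateFunctional (fun _ _ v => Finset.univ.sup v) (-1) x γ
      fun a => (g a).toNNReal where
  monotone := hg
  map_pow a n := by rw [_root_.map_pow, TropicalReal.toNNReal_pow]
  map_diagPair {ι} _ _ p q := by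
    let e : Fin (Fintype.card ι) ≃ ι := (Fintype.equivFin ι).symm
    rw [FamilyPair.mk_diagPair_eq_classicalSum p q e]
    refine (h _ (p ∘ e) (q ∘ e)).trans ?_
    have hval : ∀ i, Real.toNNReal ((p i).1 x * Real.exp (-∫ y, Real.log ((q i).1 y) ∂γ))
        = ((p i).1 x).toNNReal * expWeight γ (-1) (q i) ^ 2 := by
      intro i
      rw [Real.toNNReal_mul ((p i).2 x).le]
      congr 1
      apply NNReal.coe_injective
      rw [expWeight_sq, Real.coe_toNNReal _ (Real.exp_pos _).le, neg_one_mul]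
    refine le_antisymm (Finset.sup_le fun i _ => ?_) (Finset.sup_le fun i _ => ?_)
    · exact (hval (e i)).le.trans
        (Finset.le_sup (f := fun i => ((p i).1 x).toNNReal * expWeight γ (-1) (q i) ^ 2)
          (Finset.mem_univ (e i)))
    · refine Finset.le_sup_of_le (Finset.mem_univ (e.symm i)) ?_
      simp only [Function.comp_apply, Equiv.apply_symm_apply]
      exact (hval i).ge

end SpectralPoints

/-- For `R = ρ ^ (1 / 2)` and `Z = τ ^ (-1 / 2)` the two matrices are `(R * Z) * (R * Z)ᴴ` and `(R *
Z)ᴴ * (R * Z)`. -/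
theorem operatorNorm_sqrt_mul_inv_mul_sqrt {ι : Type} [Fintype ι] [DecidableEq ι]
    {ρ τ : Matrix ι ι ℂ} (hρ : ρ.PosDef) (hτ : τ.PosDef) :
    operatorNorm (matrixPow ρ (1 / 2) * τ⁻¹ * matrixPow ρ (1 / 2))
      = operatorNorm (matrixPow τ (-1 / 2) * ρ * matrixPow τ (-1 / 2)) := by
  obtain ⟨U, hU, hU', r, hr, rfl⟩ := exists_unitary_diagonal_posDef hρ
  obtain ⟨V, hV, hV', t, ht, rfl⟩ := exists_unitary_diagonal_posDef hτ
  rw [matrixPow_conj_diagonal hU, matrixPow_conj_diagonal hV]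
  set R := U * Matrix.diagonal (fun i => ((r i ^ (1 / 2 : ℝ) : ℝ) : ℂ)) * Uᴴ with hR
  set Z := V * Matrix.diagonal (fun i => ((t i ^ (-1 / 2 : ℝ) : ℝ) : ℂ)) * Vᴴ with hZ
  have hRH : Rᴴ = R := isHermitian_conj_diagonal U _
  have hZH : Zᴴ = Z := isHermitian_conj_diagonal V _
  have hRR : U * Matrix.diagonal (fun i => ((r i : ℝ) : ℂ)) * Uᴴ = R * R := by
    rw [hR, conj_mul_conj hU, Matrix.diagonal_mul_diagonal]
    congr 3
    funext i
    rw [← Complex.ofReal_mul, ← Real.rpow_add (hr i), add_halves, Real.rpow_one]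
  have hZZ : (V * Matrix.diagonal (fun i => ((t i : ℝ) : ℂ)) * Vᴴ)⁻¹ = Z * Z := by
    refine Matrix.inv_eq_right_inv ?_
    rw [hZ, conj_mul_conj hV, conj_mul_conj hV, Matrix.diagonal_mul_diagonal,
      Matrix.diagonal_mul_diagonal]
    have : (fun i => ((t i : ℝ) : ℂ) *
        (((t i ^ (-1 / 2 : ℝ) : ℝ) : ℂ) * ((t i ^ (-1 / 2 : ℝ) : ℝ) : ℂ))) = fun _ => 1 := by
      funext i
      rw [← Complex.ofReal_mul, ← Complex.ofReal_mul, ← Real.rpow_add (ht i), add_halves,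
        Real.rpow_neg_one, mul_inv_cancel₀ (ht i).ne', Complex.ofReal_one]
    rw [this, Matrix.diagonal_one, Matrix.mul_one, hV']
  have h := operatorNorm_mul_conjTranspose_self (R * Z)
  rw [Matrix.conjTranspose_mul, hRH, hZH] at h
  rw [hZZ, hRR]
  simpa only [Matrix.mul_assoc] using h

theorem mainTheorem2 {X : Type u} {Y : Type v}
    [TopologicalSpace X] [CompactSpace X] [T2Space X] [Nonempty X]
    [TopologicalSpace Y] [CompactSpace Y] [T2Space Y] [Nonempty Y]
    [MeasurableSpace Y] [BorelSpace Y]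
    (P : FamilyPair X Y) (hcomm : ∀ y y' : Y, Commute (P.sigma y) (P.sigma y')) :
    (∀ f ∈ realSpectrum (FamilySemiring X Y),
      ∀ (α : ℝ) (x : X) (γ : Measure Y), 1 ≤ α → IsProbabilityMeasure γ →
        IsClassicalReal (f.domRestrict (FamilySemiring.classical X Y)) α x γ →
          (f (FamilySemiring.mk P) : ℝ) =
            sandwichedQuasiEntropy α (P.rho x) (expIntLog γ P.sigma)) ∧
    (∀ g ∈ tropicalSpectrum (FamilySemiring X Y) (FamilySemiring.powerUniversal X Y),
      ∀ (x : X) (γ : Measure Y), IsProbabilityMeasure γ →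
        IsClassicalTropical (g.domRestrict (FamilySemiring.classical X Y)) x γ →
          ((g (FamilySemiring.mk P)).toNNReal : ℝ) =
            operatorNorm (matrixPow (P.rho x) (1 / 2) * (expIntLog γ P.sigma)⁻¹ *
              matrixPow (P.rho x) (1 / 2))) := by
  refine ⟨fun f hf α x γ hα hγ h => ?_, fun g hg x γ hγ h => ?_⟩
  · obtain ⟨W, hW, μ, hμ, hfP⟩ := (isAggregateFunctional_of_isClassicalReal hf hα h).eq_of_commute
      (isAggregate_sum_rpow hα) P hcomm
    -- Half of the exponent `(1 - α) / α` is the sandwiching exponent `(1 - α) / (2 * α)`.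
    rw [div_div, mul_comm α 2] at hμ
    rw [hfP, sandwichedQuasiEntropy_eq_sum hW hμ]
  · obtain ⟨W, hW, μ, hμ, hgP⟩ := (isAggregateFunctional_of_isClassicalTropical hg.1
      h).eq_of_commute isAggregate_sup P hcomm
    have hτ : (expIntLog γ P.sigma).PosDef := by
      obtain ⟨V, hV, q, hq⟩ := P.exists_diagonalizing_of_commute hcomm
      rw [funext hq, expIntLog_conj_diagonal hV]
      exact posDef_conj_diagonal (mul_eq_one_comm.1 hV) fun i => Real.exp_pos _
    rw [operatorNorm_sqrt_mul_inv_mul_sqrt (P.rho_posDef x) hτ, hμ, operatorNorm_conj_diagonal hW]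
    exact congrArg _ hgP

end
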